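/- Let $G$ be a (discrete) group, $L\ge 1$, and $T\in\mathrm{Aut}(G)$ with $T^L=\mathrm{id}$. For each site $j\in\mathbb{Z}/L$ let $g\mapsto U_{g,j}$ be a (linear) unitary representation of $G$ on $\mathbb{C}^d$, and put $\mathcal{U}_g=\bigotimes_{j\in\mathbb Z/L}U_{g,j}$ on the periodic chain of $L$ sites. Assume that the one-site translation $\mathcal{T}$ (which moves an operator from site $j+1$ to site $j$) acts on the symmetry by the automorphism $T$: $\mathcal{T}\,\mathcal{U}_g\,\mathcal{T}^\dagger=\mathcal{U}_{T(g)}$ for all $g$. Let $A=(A^s)_{s=1}^d$ be $\chi\times\chi$ complex matrices. Assume that $A$ is left-canonical: $\sum_s A^{s\dagger}A^s=\mathbb 1$ and $\sum_s A^s\rho A^{s\dagger}=\rho$ for some positive definite $\rho$. Assume also that $A$ is injective: the transfer matrix $\mathbb{E}=\sum_s A^s\otimes (A^s)^*$ has a dominant eigenvalue whose eigenvector is unique up to scalars, and all other eigenvalues are strictly smaller in modulus. Assume that for every $g\in G$ and every $k\ge1$ the periodic matrix product state $\sum \mathrm{Tr}(A^{s_1}\cdots A^{s_{kL}})|s_1\cdots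 s_{kL}\rangle$ is mapped to a phase times itself by the $k$-fold periodic extension of $\mathcal{U}_g$. Extend $U_{g,j}$ periodically to $j\in\mathbb{Z}$. A *push-through family* consists of unitary $\chi\times\chi$ matrices $v_j(g)$ and phases $e^{i\phi_j(g)}$ ($j\in\mathbb{Z}$, $g\in G$) with $$\sum_{t}(U_{g,j})_{st}\,A^{t}=e^{i\phi_j(g)}\,v_{j-1}(g)^\dagger A^s\,v_j(g)\qquad\text{for all } s,j,g .$$ Call its phases *translation-covariant* if $e^{i\phi_{j+1}(g)}U_{T(g),j}=e^{i\phi_j(T(g))}U_{g,j+1}$ for all $j,g$; when the on-site phases are fixed so that $U_{g,j+1}=U_{T(g),j}$, this says $e^{i\phi_{j+1}(g)}=e^{i\phi_j(T(g))}$. Then: 1. There is a push-through family with translation-covariant phases and with $v_{j+L}=v_j$ for all $j$. 2. For every push-through family there are phases $e^{i\varphi_j(g)}$ with $v_{j+1}(g)=e^{i\varphi_j(g)}\,v_j(T(g))$ for all $j,g$. If its phases are translation-covariant, $\varphi_j=\varphi$ is independent of $j$: $v_{j+1}(g)=e^{i\varphi(g)}\,v_j(T(g))$. 3. For every push-through family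 the bond unitaries form projective representations: there are 2-cocycles $\omega_j\in Z^2(G,U(1))$ (trivial action of $G$ on $U(1)$) with $v_j(g)v_j(h)=\omega_j(g,h)\,v_j(gh)$. Their class $[\omega_j]=[\omega]\in H^2(G,U(1))$ does not depend on $j$, and $$[\omega(g,h)]=[\omega(T(g),T(h))]\quad\text{in } H^2(G,U(1)).$$ -/

import Mathlib

open scoped Matrix Kronecker ComplexOrder

noncomputable section

namespace ModulatedMPS

universe u

/-! ### Group cohomology with values in `U(1)` -/

/-- The coefficient module `U(1)` with trivial action of `G`
(lifted to the universe of `G`, as Mathlib's group cohomology asks). -/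
abbrev U1 (G : Type u) [Group G] : Rep.{u} (ULift.{u} ℤ) G :=
  Rep.trivial (ULift.{u} ℤ) G (Additive (ULift.{u} Circle))

/-- The group `Z²(G, U(1))` of 2-cocycles. -/
abbrev Cocycle (G : Type u) [Group G] : Type u := groupCohomology.cocycles₂ (U1 G)

/-- The value `ω(g, h) ∈ U(1)` of a 2-cocycle. -/
def Cocycle.val {G : Type u} [Group G] (ω : Cocycle G) (g h : G) : Circle :=
  (Additive.toMul (ω (g, h) : Additive (ULift.{u} Circle))).down

/-- The class `[ω] ∈ H²(G, U(1))`. -/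
def Cocycle.cls {G : Type u} [Group G] (ω : Cocycle G) : groupCohomology.H2 (U1 G) :=
  groupCohomology.H2π (U1 G) ω

/-- The pulled back cocycle `(g, h) ↦ ω(T g, T h)`. -/
def Cocycle.pullback {G : Type u} [Group G] (T : MulAut G) (ω : Cocycle G) : Cocycle G :=
  ⟨fun x => ω (T x.1, T x.2), by
    rw [groupCohomology.mem_cocycles₂_iff]
    intro g h j
    have := (groupCohomology.mem_cocycles₂_iff (A := U1 G) (ω : G × G → U1 G)).1 ω.2
      (T g) (T h) (T j)
    simpa using this⟩

/-! ### Matrix product states -/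

/-- The transfer matrix `𝔼 = ∑ₛ Aˢ ⊗ (Aˢ)*`. -/
def transferMatrix {d χ : ℕ} (A : Fin d → Matrix (Fin χ) (Fin χ) ℂ) :
    Matrix (Fin χ × Fin χ) (Fin χ × Fin χ) ℂ :=
  ∑ s, A s ⊗ₖ (A s).map (starRingEnd ℂ)

/-- Left-canonical form: the identity is a left fixed point of the transfer matrix and some
positive definite `ρ` is a right fixed point. -/
def IsLeftCanonical {d χ : ℕ} (A : Fin d → Matrix (Fin χ) (Fin χ) ℂ) : Prop :=
  ∑ s, (A s)ᴴ * A s = 1 ∧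
    ∃ ρ : Matrix (Fin χ) (Fin χ) ℂ, ρ.PosDef ∧ ∑ s, A s * ρ * (A s)ᴴ = ρ

/-- Injectivity: the transfer matrix has a dominant eigenvalue `μ₀` whose eigenvector is unique up
to scalars, and every other eigenvalue is strictly smaller in modulus (a spectral gap). -/
def IsInjective {d χ : ℕ} (A : Fin d → Matrix (Fin χ) (Fin χ) ℂ) : Prop :=
  ∃ μ₀ : ℂ,
    Module.finrank ℂ (Module.End.eigenspace (Matrix.toLin' (transferMatrix A)) μ₀) = 1 ∧
    ∀ μ : ℂ, Module.End.HasEigenvalue (Matrix.toLin' (transferMatrix A)) μ → μ ≠ μ₀ →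
      ‖μ‖ < ‖μ₀‖

/-- The state `∑ Tr(A^{s₁} ⋯ A^{sₙ}) |s₁ ⋯ sₙ⟩` on the periodic chain with `n` sites. -/
def mpsState {d χ : ℕ} (A : Fin d → Matrix (Fin χ) (Fin χ) ℂ) (n : ℕ) : (Fin n → Fin d) → ℂ :=
  fun s => Matrix.trace (List.ofFn fun j => A (s j)).prod

/-! ### Modulated symmetries -/

/-- The operator `⨂ⱼ U_{g,j}` on `n` consecutive sites, in the basis `|s₁ ⋯ sₙ⟩`; the on-site
unitaries repeat with period `L`. -/
def chainOp {G : Type u} [Group G] {L d : ℕ} (U : ZMod L → G →* Matrix.unitaryGroup (Fin d) ℂ)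
    (n : ℕ) (g : G) : Matrix (Fin n → Fin d) (Fin n → Fin d) ℂ :=
  Matrix.of fun s t => ∏ j : Fin n,
    (U ((j : ℕ) : ZMod L) g : Matrix (Fin d) (Fin d) ℂ) (s j) (t j)

/-- Translation by one site on the periodic chain with `n` sites, `|t⟩ ↦ |j ↦ t (j + 1)⟩`.
Conjugation by it moves an operator from site `j + 1` to site `j`. -/
def translation (d n : ℕ) : Matrix (Fin n → Fin d) (Fin n → Fin d) ℂ :=
  Matrix.of fun s t => if s = t ∘ finRotate n then 1 else 0

/-- The push-through condition `U_{g,j} · A = e^{i φ_j(g)} v_{j-1}(g)† A v_j(g)` on every site `j`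
of the infinite periodic extension of the chain: `v j g` lives on the bond between the
sites `j` and `j + 1`, and `p j g` is the phase `e^{i φ_j(g)}`. -/
def IsPushThrough {G : Type u} [Group G] {L d χ : ℕ}
    (U : ZMod L → G →* Matrix.unitaryGroup (Fin d) ℂ) (A : Fin d → Matrix (Fin χ) (Fin χ) ℂ)
    (v : ℤ → G → Matrix.unitaryGroup (Fin χ) ℂ) (p : ℤ → G → Circle) : Prop :=
  ∀ (j : ℤ) (g : G) (s : Fin d),
    ∑ t, (U (j : ZMod L) g : Matrix (Fin d) (Fin d) ℂ) s t • A t =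
      (p j g : ℂ) • ((v (j - 1) g : Matrix (Fin χ) (Fin χ) ℂ)ᴴ * A s *
        (v j g : Matrix (Fin χ) (Fin χ) ℂ))

/-- The push-through phases are normalized compatibly with translation. When the on-site phases
are fixed so that `U_{g,j+1} = U_{T g,j}`, this says `p_{j+1}(g) = p_j(T g)`. -/
def IsCovariantPhase {G : Type u} [Group G] {L d : ℕ} (T : MulAut G)
    (U : ZMod L → G →* Matrix.unitaryGroup (Fin d) ℂ) (p : ℤ → G → Circle) : Prop :=
  ∀ (j : ℤ) (g : G),
    (p (j + 1) g : ℂ) • (U (j : ZMod L) (T g) : Matrix (Fin d) (Fin d) ℂ) =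
      (p j (T g) : ℂ) • (U ((j : ZMod L) + 1) g : Matrix (Fin d) (Fin d) ℂ)

end ModulatedMPS

end

/-!
The symmetry of the state says that the mixed transfer matrix along one period, between `A` and
`U_g · A`, has powers whose traces do not decay, so it has an eigenvalue of modulus at least one.
The Cauchy–Schwarz inequality for the inner product weighted by `ρ` caps the modulus at one, and its
equality case turns the eigenvector into a cyclic family of intertwiners between `A` and `U_g · A`,
which the spectral gap forces to be unitary up to scale: these are the bond unitaries.

The same spectral gap gives rigidity: if a family of bond unitaries and phases, extending
indefinitely to the left, leaves `A` fixed, then its unitaries are scalars. Hence two push-through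
families of the same tensor differ by phases `φ_j` on the bonds, and the on-site phases differ by
the gradient of `φ`. Comparing the families of `g` at the site `j + 1` and of `T g` at the site `j`
gives the translation phases, and comparing the families of `g` times `h` and of `g * h` gives the
cocycles; the gradient relation makes the former constant and the latter cohomologous along
the chain.

On the finite periodic chain the product of the on-site phases is therefore an invariant, and a
translation-covariant choice of phases exists because the action of `U(1)` on the on-site unitaries
is free and `U(1)` has `L`-th roots.
-/

noncomputable section

namespace ModulatedMPS

open Filter Topology

section PowersOfMatrices

theorem tendsto_pow_zero_of_spectralRadius_lt_one {R : Type*} [NormedRing R] [NormedAlgebra ℂ R]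
    [CompleteSpace R] {a : R} (ha : spectralRadius ℂ a < 1) :
    Tendsto (fun k : ℕ => a ^ k) atTop (𝓝 0) := by
  obtain ⟨c, hac, hc⟩ := exists_between ha
  have hle : ∀ᶠ k : ℕ in atTop, (‖a ^ k‖₊ : ENNReal) ≤ c ^ k := by
    have hgelfand := spectrum.pow_nnnorm_pow_one_div_tendsto_nhds_spectralRadius a
    filter_upwards [hgelfand.eventually_lt_const hac, eventually_gt_atTop 0] with k hk hk0
    have hk0' : (0 : ℝ) < k := Nat.cast_pos.2 hk0
    simpa using (ENNReal.rpow_inv_le_iff hk0').1 (by simpa using hk.le)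
  refine tendsto_zero_iff_norm_tendsto_zero.2 ?_
  have hlim := tendsto_of_tendsto_of_tendsto_of_le_of_le' tendsto_const_nhds
    (ENNReal.tendsto_pow_atTop_nhds_zero_of_lt_one hc) (.of_forall fun _ => zero_le) hle
  simpa [Function.comp_def] using (ENNReal.tendsto_toReal ENNReal.zero_ne_top).comp hlim

variable {n : Type*} [Fintype n] [DecidableEq n] {M : Matrix n n ℂ}

theorem hasEigenvalue_toLin'_iff {μ : ℂ} :
    Module.End.HasEigenvalue (Matrix.toLin' M) μ ↔ ∃ x ≠ 0, M *ᵥ x = μ • x := by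
  constructor
  · intro h
    obtain ⟨x, hx⟩ := h.exists_hasEigenvector
    exact ⟨x, hx.2, by simpa only [Matrix.toLin'_apply] using hx.apply_eq_smul⟩
  · rintro ⟨x, hx0, hx⟩
    exact Module.End.hasEigenvalue_of_hasEigenvector
      ⟨Module.End.mem_eigenspace_iff.2 (by rwa [Matrix.toLin'_apply]), hx0⟩

section

attribute [local instance] Matrix.linftyOpNormedRing Matrix.linftyOpNormedAlgebra

theorem tendsto_matrix_pow_zero (hM : ∀ (μ : ℂ) (x : n → ℂ), x ≠ 0 → M *ᵥ x = μ • x → ‖μ‖ < 1) :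
    Tendsto (fun k : ℕ => M ^ k) atTop (𝓝 0) := by
  cases isEmpty_or_nonempty n
  · exact tendsto_const_nhds.congr fun k => Subsingleton.elim _ _
  · refine tendsto_pow_zero_of_spectralRadius_lt_one
      (spectrum.spectralRadius_lt_of_forall_lt M fun μ hμ => ?_)
    rw [← Matrix.spectrum_toLin', ← Module.End.hasEigenvalue_iff_mem_spectrum] at hμ
    obtain ⟨x, hx0, hx⟩ := hasEigenvalue_toLin'_iff.1 hμ
    exact_mod_cast hM μ x hx0 hx

end

variable {l r : n → ℂ}

theorem sub_vecMulVec_pow_succ_add (hr : M *ᵥ r = r) (hl : l ᵥ* M = l) (hlr : l ⬝ᵥ r = 1) (k : ℕ) :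
    (M - Matrix.vecMulVec r l) ^ (k + 1) + Matrix.vecMulVec r l = M ^ (k + 1) := by
  set P := Matrix.vecMulVec r l with hP
  have hMP : M * P = P := by rw [hP, Matrix.mul_vecMulVec, hr]
  have hPM : P * M = P := by rw [hP, Matrix.vecMulVec_mul, hl]
  have hPP : P * P = P := by
    rw [hP, Matrix.vecMulVec_mul_vecMulVec, hlr, one_smul]
  induction k with
  | zero => simp
  | succ k ih =>
    have hPpow : P * (M - P) ^ (k + 1) = 0 := by
      rw [pow_succ', ← mul_assoc, mul_sub, hPM, hPP, sub_self, zero_mul]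
    rw [pow_succ' M, ← ih, mul_add, hMP, pow_succ' (M - P) (k + 1), sub_mul, hPpow, sub_zero]

theorem tendsto_pow_vecMulVec (hr : M *ᵥ r = r) (hl : l ᵥ* M = l) (hlr : l ⬝ᵥ r = 1)
    (hfin : Module.finrank ℂ (Module.End.eigenspace (Matrix.toLin' M) 1) = 1)
    (hgap : ∀ μ : ℂ, Module.End.HasEigenvalue (Matrix.toLin' M) μ → μ ≠ 1 → ‖μ‖ < 1) :
    Tendsto (fun k : ℕ => M ^ k) atTop (𝓝 (Matrix.vecMulVec r l)) := by
  have hr0 : r ≠ 0 := by rintro rfl; simp at hlr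
  have hfix : ∀ x, M *ᵥ x = x → ∃ c : ℂ, c • r = x := by
    have hmem : ∀ x, M *ᵥ x = x → x ∈ Module.End.eigenspace (Matrix.toLin' M) 1 := fun x hx =>
      Module.End.mem_eigenspace_iff.2 (by rw [Matrix.toLin'_apply, hx, one_smul])
    intro x hx
    obtain ⟨c, hc⟩ := exists_smul_eq_of_finrank_eq_one hfin (x := ⟨r, hmem r hr⟩)
      (fun h => hr0 (congrArg Subtype.val h)) ⟨x, hmem x hx⟩
    exact ⟨c, congrArg Subtype.val hc⟩
  have hzero : Tendsto (fun k : ℕ => (M - Matrix.vecMulVec r l) ^ k) atTop (𝓝 0) := by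
    refine tendsto_matrix_pow_zero fun μ x hx0 hx => ?_
    obtain rfl | hμ0 := eq_or_ne μ 0
    · simp
    rw [Matrix.sub_mulVec, Matrix.vecMulVec_mulVec, op_smul_eq_smul] at hx
    have hlx : l ⬝ᵥ x = 0 := by
      have := congrArg (l ⬝ᵥ ·) hx
      simp only [dotProduct_sub, dotProduct_smul, Matrix.dotProduct_mulVec, hl, hlr, smul_eq_mul,
        mul_one, sub_self] at this
      exact (mul_eq_zero.1 this.symm).resolve_left hμ0
    rw [hlx, zero_smul, sub_zero] at hx
    refine hgap μ (hasEigenvalue_toLin'_iff.2 ⟨x, hx0, hx⟩) ?_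
    rintro rfl
    obtain ⟨c, rfl⟩ := hfix x (by rw [hx, one_smul])
    rw [dotProduct_smul, hlr, smul_eq_mul, mul_one] at hlx
    exact hx0 (by rw [hlx, zero_smul])
  refine (tendsto_add_atTop_iff_nat 1).1 ?_
  simpa only [sub_vecMulVec_pow_succ_add hr hl hlr, zero_add] using
    ((tendsto_add_atTop_iff_nat 1).2 hzero).add_const (Matrix.vecMulVec r l)

end PowersOfMatrices

section WeightedNorm

variable {ι m n : Type*} [Fintype ι] [Fintype m] [Fintype n] {ρ : Matrix n n ℂ}

/-- The squared Hilbert–Schmidt norm `Tr (W ρ W†)` weighted by a positive definite `ρ`. It measures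
how far a linear map `X ↦ ∑ₛ Bˢ X Aˢ†` of bond operators is from being isometric. -/
def weight (ρ : Matrix n n ℂ) (W : Matrix m n ℂ) : ℝ := (W * ρ * Wᴴ).trace.re

theorem weight_nonneg (hρ : ρ.PosSemidef) (W : Matrix m n ℂ) : 0 ≤ weight ρ W :=
  (Complex.nonneg_iff.1 (hρ.mul_mul_conjTranspose_same W).trace_nonneg).1

theorem weight_eq_zero_iff (hρ : ρ.PosDef) {W : Matrix m n ℂ} : weight ρ W = 0 ↔ W = 0 := by
  classical
  refine ⟨fun hW => ?_, fun hW => by simp [hW, weight]⟩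
  have hpos := hρ.posSemidef.mul_mul_conjTranspose_same W
  have hzero : W * ρ * Wᴴ = 0 :=
    hpos.trace_eq_zero_iff.1 (Complex.ext hW (Complex.nonneg_iff.1 hpos.trace_nonneg).2.symm)
  suffices Wᴴ = 0 by simpa using this
  refine Matrix.ext_of_mulVec_single fun i => ?_
  rw [Matrix.zero_mulVec]
  by_contra hi
  have hquad := hρ.dotProduct_mulVec_pos hi
  rw [Matrix.star_mulVec, Matrix.conjTranspose_conjTranspose, ← Matrix.dotProduct_mulVec,
    Matrix.mulVec_mulVec, Matrix.mulVec_mulVec, hzero] at hquad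
  simp at hquad

theorem weight_smul (c : ℂ) (W : Matrix m n ℂ) : weight ρ (c • W) = ‖c‖ ^ 2 * weight ρ W := by
  have hc : c * star c = ((‖c‖ ^ 2 : ℝ) : ℂ) := by
    exact_mod_cast Complex.mul_conj' c
  simp only [weight, Matrix.conjTranspose_smul, Matrix.smul_mul, Matrix.mul_smul,
    Matrix.trace_smul, smul_smul, mul_comm (star c), hc, smul_eq_mul, Complex.re_ofReal_mul]

theorem weight_sub (hρ : ρ.IsHermitian) (X Y : Matrix m n ℂ) :
    weight ρ (X - Y) = weight ρ X + weight ρ Y - 2 * (X * ρ * Yᴴ).trace.re := by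
  have hsymm : (Y * ρ * Xᴴ).trace.re = (X * ρ * Yᴴ).trace.re := by
    have : (Y * ρ * Xᴴ) = (X * ρ * Yᴴ)ᴴ := by
      simp only [Matrix.conjTranspose_mul, Matrix.conjTranspose_conjTranspose, hρ.eq,
        Matrix.mul_assoc]
    rw [this, Matrix.trace_conjTranspose]
    exact Complex.conj_re _
  simp only [weight, Matrix.conjTranspose_sub, Matrix.sub_mul, Matrix.mul_sub, Matrix.trace_sub,
    Complex.sub_re]
  linarith

variable {B : ι → Matrix m m ℂ} {A : ι → Matrix n n ℂ}

theorem sum_weight_mul_left [DecidableEq m] (hB : ∑ s, (B s)ᴴ * B s = 1) (W : Matrix m n ℂ) :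
    ∑ s, weight ρ (B s * W) = weight ρ W := by
  have hcycle : ∀ s, (B s * W * ρ * (B s * W)ᴴ).trace =
      ((B s)ᴴ * B s * (W * ρ * Wᴴ)).trace := by
    intro s
    rw [Matrix.conjTranspose_mul, ← Matrix.mul_assoc, Matrix.trace_mul_comm]
    simp only [Matrix.mul_assoc]
  simp only [weight, hcycle]
  rw [← Complex.re_sum, ← Matrix.trace_sum, ← Finset.sum_mul, hB, one_mul]

theorem sum_weight_mul_right (hA : ∑ s, A s * ρ * (A s)ᴴ = ρ) (W : Matrix m n ℂ) :
    ∑ s, weight ρ (W * A s) = weight ρ W := by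
  have hassoc : ∀ s, W * A s * ρ * (W * A s)ᴴ = W * (A s * ρ * (A s)ᴴ) * Wᴴ := by
    intro s
    simp only [Matrix.conjTranspose_mul, Matrix.mul_assoc]
  simp only [weight, hassoc]
  rw [← Complex.re_sum, ← Matrix.trace_sum, ← Matrix.sum_mul, ← Matrix.mul_sum, hA]

theorem sum_weight_mul_sub_mul [DecidableEq m] (hρ : ρ.IsHermitian) (hB : ∑ s, (B s)ᴴ * B s = 1)
    (hA : ∑ s, A s * ρ * (A s)ᴴ = ρ) {W Y : Matrix m n ℂ}
    (hWY : ∑ s, B s * (W * ρ) * (A s)ᴴ = Y * ρ) :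
    ∑ s, weight ρ (B s * W - Y * A s) = weight ρ W - weight ρ Y := by
  have hcross : ∑ s, (B s * W * ρ * (Y * A s)ᴴ).trace.re = weight ρ Y := by
    have hassoc : ∀ s, B s * W * ρ * (Y * A s)ᴴ = B s * (W * ρ) * (A s)ᴴ * Yᴴ := by
      intro s
      simp only [Matrix.conjTranspose_mul, Matrix.mul_assoc]
    simp only [hassoc]
    rw [← Complex.re_sum, ← Matrix.trace_sum, ← Matrix.sum_mul, hWY, weight]
  simp only [weight_sub hρ]
  rw [Finset.sum_sub_distrib, Finset.sum_add_distrib, sum_weight_mul_left hB,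
    sum_weight_mul_right hA, ← Finset.mul_sum, hcross]
  ring

end WeightedNorm

section TransferMatrices

variable {ι m n : Type*}

/-- A vector on a doubled bond index, read as a matrix. -/
def unvec : (m × n → ℂ) ≃ₗ[ℂ] Matrix m n ℂ := LinearEquiv.curry ℂ ℂ m n

@[simp]
theorem unvec_apply (x : m × n → ℂ) (i : m) (j : n) : unvec x i j = x (i, j) := rfl

theorem unvec_symm_apply (X : Matrix m n ℂ) (i : m × n) : unvec.symm X i = X i.1 i.2 := rfl

theorem unvec_symm_one_dotProduct [Fintype n] [DecidableEq n] (x : n × n → ℂ) :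
    unvec.symm 1 ⬝ᵥ x = (unvec x).trace := by
  simp [dotProduct, unvec_symm_apply, Fintype.sum_prod_type, Matrix.trace, Matrix.one_apply]

variable [Fintype ι]

/-- The mixed transfer matrix `∑ₛ Bˢ ⊗ (Aˢ)*` of two tensors, whose products compute overlaps of
the matrix product states of `B` and `A`. -/
def mixedTransfer (B : ι → Matrix m m ℂ) (A : ι → Matrix n n ℂ) : Matrix (m × n) (m × n) ℂ :=
  ∑ s, B s ⊗ₖ (A s).map (starRingEnd ℂ)

theorem unvec_mixedTransfer_mulVec [Fintype m] [Fintype n] (B : ι → Matrix m m ℂ)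
    (A : ι → Matrix n n ℂ) (x : m × n → ℂ) :
    unvec (mixedTransfer B A *ᵥ x) = ∑ s, B s * unvec x * (A s)ᴴ := by
  rw [mixedTransfer, Matrix.sum_mulVec, map_sum]
  refine Finset.sum_congr rfl fun s _ => ?_
  ext i j
  simp only [unvec_apply, Matrix.mulVec, dotProduct, Fintype.sum_prod_type, Matrix.mul_apply,
    Matrix.kronecker_apply, Matrix.map_apply, Matrix.conjTranspose_apply, Finset.sum_mul]
  rw [Finset.sum_comm]
  exact Finset.sum_congr rfl fun k _ => Finset.sum_congr rfl fun l _ => mul_right_comm _ _ _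

variable [Fintype n] {A : ι → Matrix n n ℂ}

/-- The map `Z ↦ ∑ₛ Aˢ† Z Aˢ` of bond operators, dual to the transfer matrix under the trace
pairing. -/
def dualTransfer (A : ι → Matrix n n ℂ) (Z : Matrix n n ℂ) : Matrix n n ℂ :=
  ∑ s, (A s)ᴴ * Z * A s

theorem trace_dualTransfer_mul (Z : Matrix n n ℂ) (x : n × n → ℂ) :
    (dualTransfer A Z * unvec x).trace = (Z * unvec (mixedTransfer A A *ᵥ x)).trace := by
  rw [unvec_mixedTransfer_mulVec, dualTransfer]
  simp only [Matrix.mul_sum, Matrix.sum_mul, Matrix.trace_sum]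
  refine Finset.sum_congr rfl fun s _ => ?_
  rw [← Matrix.mul_assoc, Matrix.trace_mul_comm (Z * (A s * unvec x))]
  simp only [Matrix.mul_assoc]

variable [DecidableEq n]

theorem unvec_symm_one_vecMul_mixedTransfer (hA : ∑ s, (A s)ᴴ * A s = 1) :
    unvec.symm 1 ᵥ* mixedTransfer A A = unvec.symm 1 := by
  refine dotProduct_eq _ _ fun x => ?_
  rw [← Matrix.dotProduct_mulVec, unvec_symm_one_dotProduct, unvec_symm_one_dotProduct,
    ← one_mul (unvec _), ← trace_dualTransfer_mul, dualTransfer]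
  simp only [mul_one, hA, one_mul]

theorem norm_le_one_of_mixedTransfer_mulVec {ρ : Matrix n n ℂ} (hρ : ρ.PosDef)
    (hA : ∑ s, (A s)ᴴ * A s = 1) (hAρ : ∑ s, A s * ρ * (A s)ᴴ = ρ) {μ : ℂ} {x : n × n → ℂ}
    (hx0 : x ≠ 0) (hx : mixedTransfer A A *ᵥ x = μ • x) : ‖μ‖ ≤ 1 := by
  set W := unvec x * ρ⁻¹
  have hWρ : W * ρ = unvec x := Matrix.nonsing_inv_mul_cancel_right _ _ hρ.det_pos.ne'.isUnit
  have hW0 : W ≠ 0 := by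
    intro h
    rw [h, zero_mul] at hWρ
    exact hx0 (unvec.map_eq_zero_iff.1 hWρ.symm)
  have hpos : 0 < weight ρ W :=
    (weight_nonneg hρ.posSemidef W).lt_of_ne' (mt (weight_eq_zero_iff hρ).1 hW0)
  have hmap : ∑ s, A s * (W * ρ) * (A s)ᴴ = (μ • W) * ρ := by
    rw [Matrix.smul_mul, hWρ, ← unvec_mixedTransfer_mulVec, hx, map_smul]
  have hdefect : 0 ≤ weight ρ W - weight ρ (μ • W) := by
    rw [← sum_weight_mul_sub_mul hρ.isHermitian hA hAρ hmap]
    exact Finset.sum_nonneg fun s _ => weight_nonneg hρ.posSemidef _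
  rw [weight_smul, sub_nonneg] at hdefect
  have hsq : ‖μ‖ ^ 2 ≤ 1 := le_of_mul_le_mul_right (by rwa [one_mul]) hpos
  exact (sq_le_one_iff₀ (norm_nonneg μ)).1 hsq

end TransferMatrices

theorem exists_eq_smul_one_of_trace_mul_eq_zero {n R : Type*} [Fintype n] [DecidableEq n]
    [Nonempty n] [CommRing R] {Y : Matrix n n R}
    (hY : ∀ X : Matrix n n R, X.trace = 0 → (Y * X).trace = 0) : ∃ c : R, Y = c • 1 := by
  obtain ⟨i⟩ := ‹Nonempty n›
  refine ⟨Y i i, Matrix.ext_iff_trace_mul_right.2 fun X => ?_⟩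
  have hX := hY (X - X.trace • Matrix.single i i 1) (by simp)
  rw [Matrix.mul_sub, Matrix.trace_sub, Matrix.mul_smul, Matrix.trace_smul, Matrix.trace_mul_single,
    sub_eq_zero] at hX
  simp [hX, mul_comm]

section CanonicalForm

variable {d χ : ℕ} {A : Fin d → Matrix (Fin χ) (Fin χ) ℂ}

theorem transferMatrix_eq_mixedTransfer : transferMatrix A = mixedTransfer A A := rfl

theorem IsInjective.nonempty (hinj : IsInjective A) : Nonempty (Fin χ) := by
  obtain ⟨μ₀, hfin, -⟩ := hinj
  by_contra hempty
  rw [not_nonempty_iff] at hempty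
  rw [Module.finrank_zero_of_subsingleton] at hfin
  exact zero_ne_one hfin

theorem IsLeftCanonical.nonempty_physical [Nonempty (Fin χ)] (hcan : IsLeftCanonical A) :
    Nonempty (Fin d) := by
  by_contra hempty
  rw [not_nonempty_iff] at hempty
  have hsum := hcan.1
  rw [Finset.univ_eq_empty, Finset.sum_empty] at hsum
  exact zero_ne_one hsum

theorem IsLeftCanonical.exists_posDef_trace_one (hcan : IsLeftCanonical A) (hinj : IsInjective A) :
    ∃ ρ : Matrix (Fin χ) (Fin χ) ℂ, ρ.PosDef ∧ ρ.trace = 1 ∧ ∑ s, A s * ρ * (A s)ᴴ = ρ := by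
  have := hinj.nonempty
  obtain ⟨-, ρ, hρ, hAρ⟩ := hcan
  refine ⟨ρ.trace⁻¹ • ρ, hρ.smul (inv_pos.2 hρ.trace_pos), ?_, ?_⟩
  · rw [Matrix.trace_smul, smul_eq_mul, inv_mul_cancel₀ hρ.trace_pos.ne']
  · simp only [Matrix.mul_smul, Matrix.smul_mul, ← Finset.smul_sum, hAρ]

theorem transferMatrix_mulVec_unvec_symm {ρ : Matrix (Fin χ) (Fin χ) ℂ}
    (hAρ : ∑ s, A s * ρ * (A s)ᴴ = ρ) :
    transferMatrix A *ᵥ unvec.symm ρ = unvec.symm ρ := by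
  rw [LinearEquiv.eq_symm_apply, transferMatrix_eq_mixedTransfer, unvec_mixedTransfer_mulVec,
    LinearEquiv.apply_symm_apply, hAρ]

theorem IsInjective.finrank_eigenspace_one_and_gap (hinj : IsInjective A)
    (hcan : IsLeftCanonical A) :
    Module.finrank ℂ (Module.End.eigenspace (Matrix.toLin' (transferMatrix A)) 1) = 1 ∧
      ∀ μ : ℂ, Module.End.HasEigenvalue (Matrix.toLin' (transferMatrix A)) μ → μ ≠ 1 →
        ‖μ‖ < 1 := by
  have := hinj.nonempty
  obtain ⟨ρ, hρ, hρ1, hAρ⟩ := hcan.exists_posDef_trace_one hinj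
  obtain ⟨μ₀, hfin, hgap⟩ := hinj
  suffices hμ₀ : μ₀ = 1 by
    subst hμ₀
    exact ⟨hfin, by simpa only [norm_one] using hgap⟩
  have hρ0 : unvec.symm ρ ≠ 0 := unvec.symm.map_eq_zero_iff.not.2 (by rintro rfl; simp at hρ1)
  have hone : Module.End.HasEigenvalue (Matrix.toLin' (transferMatrix A)) 1 :=
    hasEigenvalue_toLin'_iff.2
      ⟨unvec.symm ρ, hρ0, by rw [one_smul, transferMatrix_mulVec_unvec_symm hAρ]⟩
  have hdom : Module.End.HasEigenvalue (Matrix.toLin' (transferMatrix A)) μ₀ := by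
    rw [Module.End.hasEigenvalue_iff, ← Submodule.one_le_finrank_iff, hfin]
  obtain ⟨x, hx0, hx⟩ := hasEigenvalue_toLin'_iff.1 hdom
  by_contra hne
  have hlt := hgap 1 hone (Ne.symm hne)
  rw [norm_one] at hlt
  exact hlt.not_ge (norm_le_one_of_mixedTransfer_mulVec hρ hcan.1 hAρ hx0 hx)

theorem IsInjective.tendsto_transferMatrix_pow (hinj : IsInjective A) (hcan : IsLeftCanonical A) :
    ∃ ρ : Matrix (Fin χ) (Fin χ) ℂ, ρ.trace = 1 ∧
      Tendsto (fun k : ℕ => transferMatrix A ^ k) atTop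
        (𝓝 (Matrix.vecMulVec (unvec.symm ρ) (unvec.symm 1))) := by
  obtain ⟨ρ, -, hρ1, hAρ⟩ := hcan.exists_posDef_trace_one hinj
  obtain ⟨hfin, hgap⟩ := hinj.finrank_eigenspace_one_and_gap hcan
  refine ⟨ρ, hρ1, tendsto_pow_vecMulVec (transferMatrix_mulVec_unvec_symm hAρ)
    (unvec_symm_one_vecMul_mixedTransfer hcan.1) ?_ hfin hgap⟩
  rw [unvec_symm_one_dotProduct, LinearEquiv.apply_symm_apply, hρ1]

theorem IsInjective.tendsto_trace_transferMatrix_pow (hinj : IsInjective A)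
    (hcan : IsLeftCanonical A) :
    Tendsto (fun k : ℕ => (transferMatrix A ^ k).trace) atTop (𝓝 1) := by
  obtain ⟨ρ, hρ1, hlim⟩ := hinj.tendsto_transferMatrix_pow hcan
  have htrace : (Matrix.vecMulVec (unvec.symm ρ) (unvec.symm 1)).trace = 1 := by
    rw [Matrix.trace_vecMulVec, dotProduct_comm, unvec_symm_one_dotProduct,
      LinearEquiv.apply_symm_apply, hρ1]
  rw [← htrace]
  exact (continuous_id.matrix_trace.tendsto _).comp hlim

section BackwardOrbits

variable {Y : ℕ → Matrix (Fin χ) (Fin χ) ℂ} {z : ℕ → ℂ}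

theorem norm_trace_mul_le_of_backward_orbit (hz : ∀ k, ‖z k‖ ≤ 1)
    (hY : ∀ k, Y k = z k • dualTransfer A (Y (k + 1))) (x : Fin χ × Fin χ → ℂ) (k : ℕ) :
    ‖(Y 0 * unvec x).trace‖ ≤ ‖(Y k * unvec (transferMatrix A ^ k *ᵥ x)).trace‖ := by
  induction k with
  | zero => simp
  | succ k ih =>
    refine ih.trans ?_
    rw [hY k, Matrix.smul_mul, Matrix.trace_smul, trace_dualTransfer_mul,
      ← transferMatrix_eq_mixedTransfer, Matrix.mulVec_mulVec, ← pow_succ', norm_smul]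
    exact mul_le_of_le_one_left (norm_nonneg _) (hz k)

theorem IsInjective.eq_smul_one_of_backward_orbit (hinj : IsInjective A)
    (hcan : IsLeftCanonical A) (hz : ∀ k, ‖z k‖ ≤ 1)
    (hY : ∀ k, Y k = z k • dualTransfer A (Y (k + 1))) {C : ℝ} (hC : ∀ k i j, ‖Y k i j‖ ≤ C) :
    ∃ c : ℂ, Y 0 = c • 1 := by
  have := hinj.nonempty
  refine exists_eq_smul_one_of_trace_mul_eq_zero fun X hX => norm_le_zero_iff.1 ?_
  obtain ⟨x, rfl⟩ := unvec.surjective X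
  obtain ⟨ρ, -, hlim⟩ := hinj.tendsto_transferMatrix_pow hcan
  have hzero : Tendsto (fun k : ℕ => transferMatrix A ^ k *ᵥ x) atTop (𝓝 0) := by
    have hmulVec : Continuous fun M : Matrix (Fin χ × Fin χ) (Fin χ × Fin χ) ℂ =>
        M *ᵥ x := continuous_id.matrix_mulVec continuous_const
    simpa only [Matrix.vecMulVec_mulVec, unvec_symm_one_dotProduct, hX, MulOpposite.op_zero,
      zero_smul, Function.comp_def] using (hmulVec.tendsto _).comp hlim
  have hbound : Tendsto
      (fun k : ℕ => ∑ i, ∑ j, C * ‖(transferMatrix A ^ k *ᵥ x) (j, i)‖) atTop (𝓝 0) := by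
    simpa using tendsto_finsetSum (Finset.univ : Finset (Fin χ)) fun i _ =>
      tendsto_finsetSum (Finset.univ : Finset (Fin χ)) fun j _ =>
        ((tendsto_pi_nhds.1 hzero (j, i)).norm.const_mul C)
  refine ge_of_tendsto' hbound fun k => (norm_trace_mul_le_of_backward_orbit hz hY x k).trans ?_
  simp only [Matrix.trace, Matrix.diag_apply, Matrix.mul_apply, unvec_apply]
  refine (norm_sum_le _ _).trans (Finset.sum_le_sum fun i _ => ?_)
  refine (norm_sum_le _ _).trans (Finset.sum_le_sum fun j _ => ?_)
  rw [norm_mul]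
  exact mul_le_mul_of_nonneg_right (hC k i j) (norm_nonneg _)

end BackwardOrbits

end CanonicalForm

section SiteAction

variable {ι n : Type*} [Fintype ι] (W W' : Matrix ι ι ℂ) (A : ι → Matrix n n ℂ)

/-- The action of a one-site operator on the physical index of a tensor. -/
def siteAct (s : ι) : Matrix n n ℂ := ∑ t, W s t • A t

theorem siteAct_mul : siteAct (W * W') A = siteAct W (siteAct W' A) := by
  ext1 s
  simp only [siteAct, Matrix.mul_apply, Finset.sum_smul, Finset.smul_sum, smul_smul]
  exact Finset.sum_comm

theorem siteAct_smul_left (c : ℂ) : siteAct (c • W) A = c • siteAct W A := by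
  ext1 s
  simp only [siteAct, Pi.smul_apply, Matrix.smul_apply, smul_eq_mul, Finset.smul_sum, smul_smul]

theorem siteAct_smul_right (c : ℂ) : siteAct W (c • A) = c • siteAct W A := by
  ext1 s
  simp only [siteAct, Pi.smul_apply, Finset.smul_sum, smul_comm c]

variable {W A} [DecidableEq ι] [Fintype n] [DecidableEq n]

theorem sum_conjTranspose_siteAct_mul_siteAct (hW : Wᴴ * W = 1) (hA : ∑ s, (A s)ᴴ * A s = 1) :
    ∑ s, (siteAct W A s)ᴴ * siteAct W A s = 1 := by
  have hentry : ∀ t u, ∑ s, star (W s t) * W s u = (1 : Matrix ι ι ℂ) t u := fun t u => by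
    rw [← hW, Matrix.mul_apply]
    rfl
  calc ∑ s, (siteAct W A s)ᴴ * siteAct W A s
      = ∑ s, ∑ t, ∑ u, (star (W s t) * W s u) • ((A t)ᴴ * A u) := by
        simp only [siteAct, Matrix.conjTranspose_sum, Matrix.conjTranspose_smul,
          Finset.sum_mul_sum, smul_mul_smul_comm]
    _ = ∑ t, ∑ u, (∑ s, star (W s t) * W s u) • ((A t)ᴴ * A u) := by
        simp only [Finset.sum_smul]
        rw [Finset.sum_comm]
        exact Finset.sum_congr rfl fun t _ => Finset.sum_comm
    _ = 1 := by
        simp only [hentry, Matrix.one_apply, ite_smul, one_smul, zero_smul, Finset.sum_ite_eq,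
          Finset.mem_univ, if_true, hA]

end SiteAction

section Overlaps

theorem list_prod_ofFn_sum {ι R : Type*} [Fintype ι] [Semiring R] {k : ℕ} (M : Fin k → ι → R) :
    (List.ofFn fun j => ∑ s, M j s).prod =
      ∑ s : Fin k → ι, (List.ofFn fun j => M j (s j)).prod := by
  simpa only [MultilinearMap.mkPiAlgebraFin_apply] using
    (MultilinearMap.mkPiAlgebraFin ℕ k R).map_sum fun j => M j

theorem list_prod_ofFn_smul {S R : Type*} [CommSemiring S] [Semiring R] [Algebra S R] {k : ℕ}
    (c : Fin k → S) (M : Fin k → R) :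
    (List.ofFn fun j => c j • M j).prod = (∏ j, c j) • (List.ofFn M).prod := by
  simpa only [MultilinearMap.mkPiAlgebraFin_apply] using
    (MultilinearMap.mkPiAlgebraFin S k R).map_smul_univ c M

theorem list_prod_ofFn_kronecker {m n : Type*} [Fintype m] [Fintype n] [DecidableEq m]
    [DecidableEq n] {R : Type*} [CommSemiring R] :
    ∀ {k : ℕ} (X : Fin k → Matrix m m R) (Y : Fin k → Matrix n n R),
      (List.ofFn fun j => X j ⊗ₖ Y j).prod = (List.ofFn X).prod ⊗ₖ (List.ofFn Y).prod
  | 0, _, _ => by simp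
  | k + 1, X, Y => by
    simp only [List.ofFn_succ, List.prod_cons, Matrix.mul_kronecker_mul]
    rw [list_prod_ofFn_kronecker (fun j => X j.succ) fun j => Y j.succ]

theorem list_prod_ofFn_periodic {R : Type*} [Monoid R] {L : ℕ} (f : ZMod L → R) (k : ℕ) :
    (List.ofFn fun j : Fin (k * L) => f (j : ℕ)).prod =
      (List.ofFn fun j : Fin L => f (j : ℕ)).prod ^ k := by
  rw [List.ofFn_mul]
  simp

theorem sum_trace_mul_conj_trace {ι n : Type*} [Fintype ι] [Fintype n] [DecidableEq n] {k : ℕ}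
    (B : Fin k → ι → Matrix n n ℂ) (A : ι → Matrix n n ℂ) :
    ∑ s : Fin k → ι, (List.ofFn fun j => B j (s j)).prod.trace *
      starRingEnd ℂ (List.ofFn fun j => A (s j)).prod.trace =
      (List.ofFn fun j => mixedTransfer (B j) A).prod.trace := by
  have hconj : ∀ s : Fin k → ι, (List.ofFn fun j => (A (s j)).map (starRingEnd ℂ)).prod =
      (List.ofFn fun j => A (s j)).prod.map (starRingEnd ℂ) := fun s => by
    rw [← RingHom.mapMatrix_apply, map_list_prod, List.map_ofFn]
    rfl
  simp only [mixedTransfer]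
  rw [list_prod_ofFn_sum, Matrix.trace_sum]
  refine Finset.sum_congr rfl fun s _ => ?_
  rw [list_prod_ofFn_kronecker, Matrix.trace_kronecker, hconj, AddMonoidHom.map_trace]

variable {G : Type*} [Group G] {L d χ : ℕ} {U : ZMod L → G →* Matrix.unitaryGroup (Fin d) ℂ}
  {A : Fin d → Matrix (Fin χ) (Fin χ) ℂ} {g : G}

theorem chainOp_mulVec_mpsState (k : ℕ) (s : Fin k → Fin d) :
    (chainOp U k g *ᵥ mpsState A k) s =
      (List.ofFn fun j : Fin k =>
        siteAct (U (j : ℕ) g : Matrix (Fin d) (Fin d) ℂ) A (s j)).prod.trace := by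
  simp only [siteAct]
  rw [list_prod_ofFn_sum, Matrix.trace_sum]
  refine Finset.sum_congr rfl fun t _ => ?_
  rw [list_prod_ofFn_smul, Matrix.trace_smul]
  rfl

theorem trace_pow_prod_mixedTransfer {k : ℕ} {z : ℂ}
    (hz : chainOp U (k * L) g *ᵥ mpsState A (k * L) = z • mpsState A (k * L)) :
    ((List.ofFn fun j : Fin L => mixedTransfer
      (siteAct (U (j : ℕ) g : Matrix (Fin d) (Fin d) ℂ) A) A).prod ^ k).trace =
      z * (transferMatrix A ^ (k * L)).trace := by
  have hE : transferMatrix A ^ (k * L) =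
      (List.ofFn fun _ : Fin (k * L) => mixedTransfer A A).prod := by
    rw [List.ofFn_const, List.prod_replicate, transferMatrix_eq_mixedTransfer]
  rw [← list_prod_ofFn_periodic (fun j : ZMod L => mixedTransfer
    (siteAct (U j g : Matrix (Fin d) (Fin d) ℂ) A) A), ← sum_trace_mul_conj_trace, hE,
    ← sum_trace_mul_conj_trace fun _ => A, Finset.mul_sum]
  refine Finset.sum_congr rfl fun s _ => ?_
  rw [← chainOp_mulVec_mpsState, hz, Pi.smul_apply, smul_eq_mul, mul_assoc]
  rfl

theorem exists_eigenvalue_prod_mixedTransfer [NeZero L] (hcan : IsLeftCanonical A)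
    (hinj : IsInjective A) (hsym : ∃ᶠ k : ℕ in atTop, ∃ z : Circle,
      chainOp U (k * L) g *ᵥ mpsState A (k * L) = (z : ℂ) • mpsState A (k * L)) :
    ∃ (μ : ℂ) (x : Fin χ × Fin χ → ℂ), 1 ≤ ‖μ‖ ∧ x ≠ 0 ∧
      (List.ofFn fun j : Fin L => mixedTransfer
        (siteAct (U (j : ℕ) g : Matrix (Fin d) (Fin d) ℂ) A) A).prod *ᵥ x = μ • x := by
  by_contra! hcon
  have hF := (continuous_id.matrix_trace.tendsto _).comp
    (tendsto_matrix_pow_zero fun μ x hx0 hx => not_le.1 fun hμ => hcon μ x hμ hx0 hx)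
  have hE := (hinj.tendsto_trace_transferMatrix_pow hcan).comp
    (tendsto_id.atTop_mul_const' (NeZero.pos L))
  have hquot := hF.norm.sub hE.norm
  simp only [id_eq, Matrix.trace_zero, norm_zero, norm_one, zero_sub] at hquot
  obtain ⟨k, ⟨z, hz⟩, hk⟩ :=
    (hsym.and_eventually (hquot.eventually_lt_const (show (-1 : ℝ) < 0 by norm_num))).exists
  simp only [Function.comp_apply, trace_pow_prod_mixedTransfer hz, norm_mul, Circle.norm_coe,
    one_mul, sub_self, lt_self_iff_false] at hk

end Overlaps

section CyclicChains

variable {L : ℕ} [NeZero L]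

theorem apply_val_add_one {α : Type*} {f : ℕ → α} (hf : f 0 = f L) (j : ZMod L) :
    f (j + 1).val = f (j.val + 1) := by
  have hcast : j + 1 = ((j.val + 1 : ℕ) : ZMod L) := by simp
  rcases (Nat.succ_le_of_lt j.val_lt).lt_or_eq with hlt | heq
  · rw [hcast, ZMod.val_natCast_of_lt hlt]
  · have hzero : j + 1 = 0 := by rw [hcast, ← Nat.succ_eq_add_one, heq, ZMod.natCast_self]
    rw [hzero, ZMod.val_zero, hf]
    exact congrArg f heq.symm

theorem exists_mulVec_eq_smul_of_prod_mulVec {R n : Type*} [CommSemiring R] [Fintype n]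
    [DecidableEq n] (M : ZMod L → Matrix n n R) {c : R} {x : n → R}
    (hx : (List.ofFn fun j : Fin L => M (j : ℕ)).prod *ᵥ x = c ^ L • x) :
    ∃ X : ZMod L → n → R, X 0 = c ^ L • x ∧ ∀ j, M j *ᵥ X (j + 1) = c • X j := by
  set l := List.ofFn fun j : Fin L => M (j : ℕ) with hl
  set f : ℕ → n → R := fun i => c ^ i • (l.drop i).prod *ᵥ x with hf
  have hf0 : f 0 = c ^ L • x := by simp only [hf, pow_zero, one_smul, List.drop_zero, hx]
  have hfL : f L = c ^ L • x := by
    simp only [hf]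
    rw [List.drop_of_length_le (by simp [hl]), List.prod_nil, Matrix.one_mulVec]
  refine ⟨fun j => f j.val, by simpa only [ZMod.val_zero] using hf0, fun j => ?_⟩
  have hdrop : (l.drop j.val).prod = M j * (l.drop (j.val + 1)).prod := by
    rw [List.drop_eq_getElem_cons (by simp [hl, j.val_lt]), List.prod_cons]
    simp [hl]
  simp only [apply_val_add_one (hf0.trans hfL.symm) j]
  simp only [hf, hdrop, Matrix.mulVec_smul, Matrix.mulVec_mulVec, pow_succ', mul_smul]

end CyclicChains

section Intertwiners

theorem eq_smul_mul_of_orbit_intertwiner {J ι m n : Type*} [Finite J] [Fintype ι] [Fintype m]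
    [Fintype n] [DecidableEq m] {ρ : Matrix n n ℂ} (hρ : ρ.PosDef) {A : ι → Matrix n n ℂ}
    (hA : ∑ s, A s * ρ * (A s)ᴴ = ρ) {B : J → ι → Matrix m m ℂ}
    (hB : ∀ j, ∑ s, (B j s)ᴴ * B j s = 1) (σ : Equiv.Perm J) {V : J → Matrix m n ℂ} (hV0 : V ≠ 0)
    {c : ℂ} (hc : 1 ≤ ‖c‖) (hV : ∀ j, ∑ s, B j s * (V (σ j) * ρ) * (A s)ᴴ = (c • V j) * ρ) :
    ‖c‖ = 1 ∧ ∀ j s, B j s * V (σ j) = c • (V j * A s) := by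
  cases nonempty_fintype J
  have hnonneg : ∀ W : Matrix m n ℂ, 0 ≤ weight ρ W := weight_nonneg hρ.posSemidef
  obtain ⟨j₀, hj₀⟩ := Function.ne_iff.1 hV0
  have hpos : 0 < ∑ j, weight ρ (V j) :=
    Finset.sum_pos' (fun j _ => hnonneg _) ⟨j₀, Finset.mem_univ _,
      (hnonneg _).lt_of_ne' (mt (weight_eq_zero_iff hρ).1 hj₀)⟩
  have htotal : ∑ j, ∑ s, weight ρ (B j s * V (σ j) - (c • V j) * A s) =
      (1 - ‖c‖ ^ 2) * ∑ j, weight ρ (V j) := by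
    simp only [sum_weight_mul_sub_mul hρ.isHermitian (hB _) hA (hV _), weight_smul]
    rw [Finset.sum_sub_distrib, Equiv.sum_comp σ fun j => weight ρ (V j), ← Finset.mul_sum]
    ring
  have hinner : ∀ j, 0 ≤ ∑ s, weight ρ (B j s * V (σ j) - (c • V j) * A s) :=
    fun j => Finset.sum_nonneg fun s _ => hnonneg _
  have hle : 0 ≤ 1 - ‖c‖ ^ 2 := by
    refine nonneg_of_mul_nonneg_left ?_ hpos
    rw [← htotal]
    exact Finset.sum_nonneg fun j _ => hinner j
  have hnorm : ‖c‖ = 1 := by nlinarith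
  refine ⟨hnorm, fun j s => ?_⟩
  rw [hnorm, one_pow, sub_self, zero_mul, Finset.sum_eq_zero_iff_of_nonneg fun j _ => hinner j]
    at htotal
  have hdefect := (Finset.sum_eq_zero_iff_of_nonneg fun s _ => hnonneg _).1
    (htotal j (Finset.mem_univ j)) s (Finset.mem_univ s)
  rw [← Matrix.smul_mul]
  exact sub_eq_zero.1 ((weight_eq_zero_iff hρ).1 hdefect)

theorem dualTransfer_conjTranspose_mul_self {ι m n : Type*} [Fintype ι] [Fintype m] [Fintype n]
    [DecidableEq m] {A : ι → Matrix n n ℂ} {B : ι → Matrix m m ℂ} (hB : ∑ s, (B s)ᴴ * B s = 1)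
    {V W : Matrix m n ℂ} {c : ℂ} (hc : ‖c‖ = 1) (hVW : ∀ s, B s * W = c • (V * A s)) :
    dualTransfer A (Vᴴ * V) = Wᴴ * W := by
  have hcc : star c * c = 1 := by
    have := Complex.conj_mul' c
    rwa [hc, Complex.ofReal_one, one_pow] at this
  have hterm : ∀ s, (A s)ᴴ * (Vᴴ * V) * A s = Wᴴ * ((B s)ᴴ * B s) * W := fun s => calc
    (A s)ᴴ * (Vᴴ * V) * A s = (c • (V * A s))ᴴ * (c • (V * A s)) := by
      rw [Matrix.conjTranspose_smul, Matrix.smul_mul, Matrix.mul_smul, smul_smul, hcc, one_smul]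
      simp only [Matrix.conjTranspose_mul, Matrix.mul_assoc]
    _ = Wᴴ * ((B s)ᴴ * B s) * W := by
      rw [← hVW s]
      simp only [Matrix.conjTranspose_mul, Matrix.mul_assoc]
  simp only [dualTransfer, hterm]
  rw [← Matrix.sum_mul, ← Matrix.mul_sum, hB, Matrix.mul_one]

theorem exists_unitary_of_conjTranspose_mul_self_eq_smul {J n : Type*} [Fintype n] [DecidableEq n]
    {V : J → Matrix n n ℂ} (hV0 : V ≠ 0) {c : ℂ} (hV : ∀ j, (V j)ᴴ * V j = c • 1) :
    ∃ (r : ℂ) (W : J → Matrix.unitaryGroup n ℂ), r ≠ 0 ∧ ∀ j, V j = r • (W j : Matrix n n ℂ) := by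
  obtain ⟨j, hj⟩ := Function.ne_iff.1 hV0
  have hne : (V j)ᴴ * V j ≠ 0 := mt Matrix.conjTranspose_mul_self_eq_zero.1 hj
  have hn : Nonempty n := by
    by_contra hempty
    rw [not_nonempty_iff] at hempty
    exact hj (Subsingleton.elim _ _)
  have hc0 : c ≠ 0 := by
    rintro rfl
    exact hne (by rw [hV, zero_smul])
  have hcnonneg : 0 ≤ c := by
    have hdiag := (Matrix.posSemidef_conjTranspose_mul_self (V j)).diag_nonneg
      (i := Classical.arbitrary n)
    simpa only [hV, Matrix.smul_apply, Matrix.one_apply_eq, smul_eq_mul, mul_one] using hdiag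
  obtain ⟨a, ha, rfl⟩ : ∃ a : ℝ, 0 < a ∧ (a : ℂ) = c :=
    ⟨c.re, (Complex.pos_iff.1 (hcnonneg.lt_of_ne' hc0)).1,
      Complex.ext rfl (Complex.nonneg_iff.1 hcnonneg).2⟩
  have hr : ((√a : ℝ) : ℂ) ≠ 0 := Complex.ofReal_ne_zero.2 (Real.sqrt_pos.2 ha).ne'
  have hnormalized : ((√a : ℝ) : ℂ)⁻¹ * (((√a : ℝ) : ℂ)⁻¹ * a) = 1 := by
    rw [← mul_assoc, ← mul_inv, ← Complex.ofReal_mul, Real.mul_self_sqrt ha.le,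
      inv_mul_cancel₀ hc0]
  refine ⟨(√a : ℝ), fun i => ⟨((√a : ℝ) : ℂ)⁻¹ • V i, Matrix.mem_unitaryGroup_iff'.2 ?_⟩, hr,
    fun i => (smul_inv_smul₀ hr _).symm⟩
  rw [Matrix.star_eq_conjTranspose, Matrix.conjTranspose_smul, smul_mul_smul_comm, hV, smul_smul,
    star_inv₀, Complex.star_def, Complex.conj_ofReal, mul_assoc, hnormalized, one_smul]

end Intertwiners

section BondAction

variable {n : Type*} [Fintype n] [DecidableEq n]

theorem circle_smul_mem_unitaryGroup (z : Circle) {u : Matrix n n ℂ}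
    (hu : u ∈ Matrix.unitaryGroup n ℂ) : z • u ∈ Matrix.unitaryGroup n ℂ := by
  rw [Circle.smul_def, Matrix.mem_unitaryGroup_iff, star_smul, smul_mul_smul_comm,
    Matrix.mem_unitaryGroup_iff.1 hu, Complex.star_def, Complex.mul_conj, Circle.normSq_coe,
    Complex.ofReal_one, one_smul]

instance : MulAction Circle (Matrix.unitaryGroup n ℂ) where
  smul z u := ⟨z • (u : Matrix n n ℂ), circle_smul_mem_unitaryGroup z u.2⟩
  one_smul _ := Subtype.ext (one_smul _ _)
  mul_smul _ _ _ := Subtype.ext (mul_smul _ _ _)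

instance : IsScalarTower Circle (Matrix.unitaryGroup n ℂ) (Matrix.unitaryGroup n ℂ) :=
  ⟨fun _ _ _ => Subtype.ext (smul_mul_assoc _ _ _)⟩

instance : SMulCommClass Circle (Matrix.unitaryGroup n ℂ) (Matrix.unitaryGroup n ℂ) :=
  ⟨fun _ _ _ => Subtype.ext (mul_smul_comm _ _ _).symm⟩

theorem coe_circle_smul (z : Circle) (u : Matrix.unitaryGroup n ℂ) :
    ((z • u : Matrix.unitaryGroup n ℂ) : Matrix n n ℂ) = (z : ℂ) • (u : Matrix n n ℂ) := rfl

theorem circle_smul_left_injective [Nonempty n] (u : Matrix.unitaryGroup n ℂ) :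
    Function.Injective fun z : Circle => z • u := fun z w hzw => by
  have hone : z • (1 : Matrix.unitaryGroup n ℂ) = w • 1 := by
    simpa only [smul_mul_assoc, mul_inv_cancel] using congrArg (· * u⁻¹) hzw
  have hentry := congrArg (fun M : Matrix.unitaryGroup n ℂ => M (Classical.arbitrary n)
    (Classical.arbitrary n)) hone
  exact Circle.ext (by simpa [coe_circle_smul] using hentry)

theorem exists_circle_smul_eq_of_coe_eq_smul [Nonempty n] {u w : Matrix.unitaryGroup n ℂ} {c : ℂ}
    (huw : (u : Matrix n n ℂ) = c • (w : Matrix n n ℂ)) : ∃ z : Circle, u = z • w := by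
  have hcc : (star c * c) • (1 : Matrix n n ℂ) = 1 := by
    have := Matrix.UnitaryGroup.star_mul_self u
    rwa [huw, star_smul, smul_mul_smul_comm, Matrix.UnitaryGroup.star_mul_self] at this
  have hnorm : ‖c‖ ^ 2 = 1 := by
    have hentry := congrFun₂ hcc (Classical.arbitrary n) (Classical.arbitrary n)
    rw [Matrix.smul_apply, Matrix.one_apply_eq, smul_eq_mul, mul_one, Complex.star_def,
      Complex.conj_mul'] at hentry
    exact_mod_cast hentry
  exact ⟨⟨c, mem_sphere_zero_iff_norm.2
    ((pow_eq_one_iff_of_nonneg (norm_nonneg c) two_ne_zero).1 hnorm)⟩, Subtype.ext huw⟩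

variable {ι : Type*}

/-- The action `Aˢ ↦ u† Aˢ v` of bond unitaries on the virtual legs of a tensor. -/
def bondAct (u v : Matrix.unitaryGroup n ℂ) (A : ι → Matrix n n ℂ) (s : ι) : Matrix n n ℂ :=
  (u : Matrix n n ℂ)ᴴ * A s * (v : Matrix n n ℂ)

variable {u u' v v' : Matrix.unitaryGroup n ℂ} {A : ι → Matrix n n ℂ}

theorem bondAct_one : bondAct 1 1 A = A := by
  ext1 s
  simp [bondAct]

theorem bondAct_mul : bondAct (u * u') (v * v') A = bondAct u' v' (bondAct u v A) := by
  ext1 s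
  simp only [bondAct, Matrix.UnitaryGroup.mul_val, Matrix.conjTranspose_mul, Matrix.mul_assoc]

theorem bondAct_smul (z w : Circle) : bondAct (z • u) (w • v) A = (z⁻¹ * w) • bondAct u v A := by
  ext1 s
  simp only [bondAct, coe_circle_smul, Matrix.conjTranspose_smul, Matrix.smul_mul, Matrix.mul_smul,
    smul_smul, Pi.smul_apply, Circle.smul_def, Circle.coe_mul, Circle.coe_inv_eq_conj,
    Complex.star_def, mul_comm]

theorem bondAct_smul_right (z : Circle) : bondAct u v (z • A) = z • bondAct u v A := by
  ext1 s
  simp only [bondAct, Pi.smul_apply, Circle.smul_def, Matrix.smul_mul, Matrix.mul_smul]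

theorem siteAct_bondAct [Fintype ι] (W : Matrix ι ι ℂ) :
    siteAct W (bondAct u v A) = bondAct u v (siteAct W A) := by
  ext1 s
  simp only [siteAct, bondAct, Matrix.mul_sum, Matrix.sum_mul, Matrix.smul_mul, Matrix.mul_smul]

theorem isPushThrough_iff {G : Type*} [Group G] {L d χ : ℕ}
    {U : ZMod L → G →* Matrix.unitaryGroup (Fin d) ℂ} {A : Fin d → Matrix (Fin χ) (Fin χ) ℂ}
    {v : ℤ → G → Matrix.unitaryGroup (Fin χ) ℂ} {p : ℤ → G → Circle} :
    IsPushThrough U A v p ↔ ∀ (j : ℤ) g, siteAct (U (j : ZMod L) g : Matrix (Fin d) (Fin d) ℂ) A =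
      p j g • bondAct (v (j - 1) g) (v j g) A :=
  forall₂_congr fun _ _ => funext_iff.symm

end BondAction

section Existence

variable {L d χ : ℕ} [NeZero L] {A : Fin d → Matrix (Fin χ) (Fin χ) ℂ}

theorem IsInjective.exists_eq_smul_one_of_cyclic_orbit (hinj : IsInjective A)
    (hcan : IsLeftCanonical A) {Z : ZMod L → Matrix (Fin χ) (Fin χ) ℂ}
    (hZ : ∀ j, dualTransfer A (Z j) = Z (j + 1)) : ∃ c : ℂ, ∀ j, Z j = c • 1 := by
  obtain ⟨C, hC⟩ : ∃ C : ℝ, ∀ (j : ZMod L) (a b : Fin χ), ‖Z j a b‖ ≤ C :=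
    ⟨∑ j, ∑ a, ∑ b, ‖Z j a b‖, fun j a b =>
      (Finset.single_le_sum (f := fun b => ‖Z j a b‖) (fun _ _ => by positivity)
        (Finset.mem_univ b)).trans <|
      (Finset.single_le_sum (f := fun a => ∑ b, ‖Z j a b‖) (fun _ _ => by positivity)
        (Finset.mem_univ a)).trans <|
      Finset.single_le_sum (f := fun j => ∑ a, ∑ b, ‖Z j a b‖) (fun _ _ => by positivity)
        (Finset.mem_univ j)⟩
  obtain ⟨c, hc⟩ := hinj.eq_smul_one_of_backward_orbit hcan (z := 1)
    (Y := fun k : ℕ => Z (-(k : ZMod L))) (fun k => by simp)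
    (fun k => by
      rw [hZ, Pi.one_apply, one_smul]
      congr 1
      push_cast
      ring)
    (fun k => hC _)
  have hnat : ∀ k : ℕ, Z k = c • 1 := by
    intro k
    induction k with
    | zero => simpa using hc
    | succ k ih =>
      rw [Nat.cast_succ, ← hZ, ih]
      simp only [dualTransfer, Matrix.mul_smul, Matrix.smul_mul, Matrix.mul_one]
      rw [← Finset.smul_sum, hcan.1]
  exact ⟨c, fun j => by rw [← ZMod.natCast_zmod_val j, hnat]⟩

variable {G : Type*} [Group G] {U : ZMod L → G →* Matrix.unitaryGroup (Fin d) ℂ} {g : G}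

theorem exists_cyclic_intertwiner (hcan : IsLeftCanonical A) (hinj : IsInjective A)
    (hsym : ∃ᶠ k in atTop, ∃ z : Circle, chainOp U (k * L) g *ᵥ mpsState A (k * L) =
      (z : ℂ) • mpsState A (k * L)) :
    ∃ (c : ℂ) (V : ZMod L → Matrix (Fin χ) (Fin χ) ℂ), ‖c‖ = 1 ∧ V ≠ 0 ∧ ∀ j s,
      siteAct (U j g : Matrix (Fin d) (Fin d) ℂ) A s * V (j + 1) = c • (V j * A s) := by
  obtain ⟨ρ, hρ, -, hA⟩ := hcan.exists_posDef_trace_one hinj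
  obtain ⟨μ, x, hμ, hx0, hx⟩ := exists_eigenvalue_prod_mixedTransfer hcan hinj hsym
  obtain ⟨c, rfl⟩ := IsAlgClosed.exists_pow_nat_eq μ (NeZero.pos L)
  have hc : 1 ≤ ‖c‖ := by
    rwa [norm_pow, one_le_pow_iff_of_nonneg (norm_nonneg c) (NeZero.ne L)] at hμ
  have hc0 : c ≠ 0 := norm_pos_iff.1 (one_pos.trans_le hc)
  obtain ⟨X, hX0, hX⟩ := exists_mulVec_eq_smul_of_prod_mulVec
    (fun j => mixedTransfer (siteAct (U j g : Matrix (Fin d) (Fin d) ℂ) A) A) hx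
  set V : ZMod L → Matrix (Fin χ) (Fin χ) ℂ := fun j => unvec (X j) * ρ⁻¹
  have hVρ : ∀ j, V j * ρ = unvec (X j) := fun j =>
    Matrix.nonsing_inv_mul_cancel_right _ _ hρ.det_pos.ne'.isUnit
  have hV0 : V ≠ 0 := by
    intro hV
    have hzero := hVρ 0
    rw [hV, Pi.zero_apply, zero_mul, eq_comm, LinearEquiv.map_eq_zero_iff, hX0] at hzero
    exact smul_ne_zero (pow_ne_zero L hc0) hx0 hzero
  obtain ⟨hc1, hBV⟩ := eq_smul_mul_of_orbit_intertwiner hρ hA (fun j =>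
    sum_conjTranspose_siteAct_mul_siteAct (Matrix.mem_unitaryGroup_iff'.1 (U j g).2) hcan.1)
    (Equiv.addRight 1) hV0 hc fun j => by
      rw [Equiv.coe_addRight, Matrix.smul_mul, hVρ, hVρ, ← unvec_mixedTransfer_mulVec, hX,
        map_smul]
  exact ⟨c, V, hc1, hV0, hBV⟩

theorem exists_siteAct_eq_smul_bondAct (hcan : IsLeftCanonical A) (hinj : IsInjective A)
    (hsym : ∃ᶠ k in atTop, ∃ z : Circle, chainOp U (k * L) g *ᵥ mpsState A (k * L) =
      (z : ℂ) • mpsState A (k * L)) :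
    ∃ (p : Circle) (v : ZMod L → Matrix.unitaryGroup (Fin χ) ℂ), ∀ j,
      siteAct (U j g : Matrix (Fin d) (Fin d) ℂ) A = p • bondAct (v (j - 1)) (v j) A := by
  obtain ⟨c, V, hc, hV0, hV⟩ := exists_cyclic_intertwiner hcan hinj hsym
  obtain ⟨a, ha⟩ := hinj.exists_eq_smul_one_of_cyclic_orbit hcan fun j =>
    dualTransfer_conjTranspose_mul_self
      (sum_conjTranspose_siteAct_mul_siteAct (Matrix.mem_unitaryGroup_iff'.1 (U j g).2) hcan.1)
      hc (hV j)
  obtain ⟨r, W, hr, hW⟩ := exists_unitary_of_conjTranspose_mul_self_eq_smul hV0 ha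
  obtain ⟨z, rfl⟩ : ∃ z : Circle, (z : ℂ) = c := ⟨⟨c, mem_sphere_zero_iff_norm.2 hc⟩, rfl⟩
  refine ⟨z, fun j => (W (j + 1))⁻¹, fun j => funext fun s => ?_⟩
  have hW' : siteAct (U j g : Matrix (Fin d) (Fin d) ℂ) A s * (W (j + 1) : Matrix _ _ ℂ) =
      (z : ℂ) • ((W j : Matrix _ _ ℂ) * A s) := by
    have := hV j s
    rw [hW, hW, Matrix.mul_smul, Matrix.smul_mul, smul_comm] at this
    exact smul_right_injective _ hr this
  rw [← mul_one (siteAct _ A s), ← Matrix.mem_unitaryGroup_iff.1 (W (j + 1)).2, ← mul_assoc, hW',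
    Matrix.smul_mul]
  simp only [sub_add_cancel, Pi.smul_apply, Circle.smul_def, bondAct, Matrix.UnitaryGroup.inv_val,
    Matrix.star_eq_conjTranspose, Matrix.conjTranspose_conjTranspose]

end Existence

section Uniqueness

variable {d χ : ℕ} {A : Fin d → Matrix (Fin χ) (Fin χ) ℂ} {J : Type*} [AddCommGroupWithOne J]

theorem eq_smul_dualTransfer_of_smul_bondAct_eq (hcan : IsLeftCanonical A)
    {u v : Matrix.unitaryGroup (Fin χ) ℂ} {q : Circle} (huv : q • bondAct u v A = A) :
    (v : Matrix (Fin χ) (Fin χ) ℂ) =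
      ((q⁻¹ : Circle) : ℂ) • dualTransfer A (u : Matrix (Fin χ) (Fin χ) ℂ) := by
  have hAv : ∀ s, A s * (v : Matrix (Fin χ) (Fin χ) ℂ) =
      q⁻¹ • ((u : Matrix (Fin χ) (Fin χ) ℂ) * A s) := fun s => by
    have hs : A s = q • ((u : Matrix (Fin χ) (Fin χ) ℂ)ᴴ * A s * v) := (congrFun huv s).symm
    conv_rhs => rw [hs, mul_smul_comm, inv_smul_smul, ← mul_assoc, ← mul_assoc,
      ← Matrix.star_eq_conjTranspose, Matrix.mem_unitaryGroup_iff.1 u.2, one_mul]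
  rw [← one_mul (v : Matrix (Fin χ) (Fin χ) ℂ), ← hcan.1, dualTransfer, Finset.sum_mul,
    Finset.smul_sum]
  refine Finset.sum_congr rfl fun s _ => ?_
  rw [mul_assoc, hAv, mul_smul_comm, mul_assoc, Circle.smul_def]

theorem IsInjective.exists_eq_circle_smul_one (hinj : IsInjective A) (hcan : IsLeftCanonical A)
    {u : J → Matrix.unitaryGroup (Fin χ) ℂ} {q : J → Circle}
    (hu : ∀ j, q j • bondAct (u (j - 1)) (u j) A = A) (j : J) : ∃ φ : Circle, u j = φ • 1 := by
  have hne := hinj.nonempty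
  obtain ⟨c, hc⟩ := hinj.eq_smul_one_of_backward_orbit hcan (C := 1)
    (z := fun k : ℕ => (((q (j - k))⁻¹ : Circle) : ℂ))
    (Y := fun k : ℕ => (u (j - k) : Matrix (Fin χ) (Fin χ) ℂ))
    (fun k => (Circle.norm_coe _).le)
    (fun k => by
      rw [eq_smul_dualTransfer_of_smul_bondAct_eq hcan (hu (j - k)), Nat.cast_succ,
        sub_add_eq_sub_sub])
    (fun k => entry_norm_bound_of_unitary (u (j - k)).2)
  exact exists_circle_smul_eq_of_coe_eq_smul (c := c) (by simpa using hc)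

theorem IsInjective.exists_phase_of_smul_bondAct_eq (hinj : IsInjective A)
    (hcan : IsLeftCanonical A) {v v' : J → Matrix.unitaryGroup (Fin χ) ℂ} {p p' : J → Circle}
    (hv : ∀ j, p j • bondAct (v (j - 1)) (v j) A = p' j • bondAct (v' (j - 1)) (v' j) A) :
    ∃ φ : J → Circle, (∀ j, v j = φ j • v' j) ∧ ∀ j, p j * φ j = p' j * φ (j - 1) := by
  have hu : ∀ j, ((p' j)⁻¹ * p j) •
      bondAct (v (j - 1) * (v' (j - 1))⁻¹) (v j * (v' j)⁻¹) A = A := fun j => by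
    rw [bondAct_mul, mul_smul, ← bondAct_smul_right, hv, bondAct_smul_right, inv_smul_smul,
      ← bondAct_mul, mul_inv_cancel, mul_inv_cancel, bondAct_one]
  choose φ hφ using hinj.exists_eq_circle_smul_one hcan
    (u := fun j => v j * (v' j)⁻¹) (q := fun j => (p' j)⁻¹ * p j) hu
  refine ⟨φ, fun j => ?_, fun j => ?_⟩
  · rw [← one_mul (v' j), ← smul_mul_assoc, ← hφ, inv_mul_cancel_right]
  · have hne := hinj.nonempty
    have hA0 : A ≠ 0 := by
      rintro rfl
      simpa using hcan.1
    have hphase : ((p' j)⁻¹ * p j * ((φ (j - 1))⁻¹ * φ j)) • A = A := by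
      have huj := hu j
      rwa [hφ, hφ, bondAct_smul, bondAct_one, ← mul_smul] at huj
    have hone := Circle.ext (smul_left_injective ℂ hA0 (hphase.trans (one_smul Circle A).symm))
    rw [mul_mul_mul_comm, ← mul_inv, inv_mul_eq_one] at hone
    exact hone.symm

end Uniqueness

section Translation

theorem translation_mul_mul_apply {d n : ℕ} (O : Matrix (Fin n → Fin d) (Fin n → Fin d) ℂ)
    (a b : Fin n → Fin d) :
    (translation d n * O * (translation d n)ᴴ) (a ∘ finRotate n) (b ∘ finRotate n) = O a b := by
  have hinj : ∀ s t : Fin n → Fin d, s ∘ finRotate n = t ∘ finRotate n ↔ s = t := fun s t =>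
    (finRotate n).surjective.injective_comp_right.eq_iff
  simp [Matrix.mul_apply, translation, hinj, Matrix.conjTranspose_apply, apply_ite star]

theorem natCast_finRotate {L : ℕ} [NeZero L] (j : Fin L) :
    ((finRotate L j : ℕ) : ZMod L) = ((j : ℕ) : ZMod L) + 1 := by
  obtain ⟨n, rfl⟩ := Nat.exists_eq_succ_of_ne_zero (NeZero.ne L)
  rw [finRotate_apply, Fin.val_add, ZMod.natCast_mod, Nat.cast_add, Fin.val_one',
    ZMod.natCast_mod, Nat.cast_one]

theorem exists_smul_eq_of_prod_apply_eq {ι m n K : Type*} [Fintype ι] [Field K]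
    {M N : ι → Matrix m n K} (hN : ∀ i, N i ≠ 0)
    (h : ∀ (s : ι → m) (t : ι → n), ∏ i, M i (s i) (t i) = ∏ i, N i (s i) (t i)) (i : ι) :
    ∃ c : K, M i = c • N i := by
  classical
  have hex : ∀ i, ∃ a b, N i a b ≠ 0 := by
    intro i
    by_contra! hz
    exact hN i (Matrix.ext hz)
  choose a b hab using hex
  have hslice : ∀ x y, M i x y * ∏ j ∈ {i}ᶜ, M j (a j) (b j) =
      N i x y * ∏ j ∈ {i}ᶜ, N j (a j) (b j) := by
    have hsplit : ∀ (P : ι → Matrix m n K) (x y),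
        ∏ j, P j (Function.update a i x j) (Function.update b i y j) =
          P i x y * ∏ j ∈ {i}ᶜ, P j (a j) (b j) := fun P x y => by
      rw [Fintype.prod_eq_mul_prod_compl i, Function.update_self, Function.update_self]
      congr 1
      refine Finset.prod_congr rfl fun j hj => ?_
      have hji : j ≠ i := by simpa using hj
      rw [Function.update_of_ne hji, Function.update_of_ne hji]
    intro x y
    rw [← hsplit, ← hsplit, h]
  set q := ∏ j ∈ {i}ᶜ, N j (a j) (b j)
  set p := ∏ j ∈ {i}ᶜ, M j (a j) (b j)
  have hp : p ≠ 0 := by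
    intro hp
    have hi := hslice (a i) (b i)
    rw [hp, mul_zero] at hi
    exact mul_ne_zero (hab i) (Finset.prod_ne_zero_iff.2 fun j _ => hab j) hi.symm
  refine ⟨q / p, Matrix.ext fun x y => ?_⟩
  rw [Matrix.smul_apply, smul_eq_mul, div_mul_eq_mul_div, eq_div_iff hp, hslice, mul_comm]

theorem unitary_coe_ne_zero {n : Type*} [Fintype n] [DecidableEq n] [Nonempty n]
    (u : Matrix.unitaryGroup n ℂ) : (u : Matrix n n ℂ) ≠ 0 := by
  intro hu
  have hone := Matrix.UnitaryGroup.star_mul_self u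
  rw [hu, mul_zero] at hone
  exact zero_ne_one hone

theorem exists_circle_smul_eq_of_translation {G : Type*} [Group G] {L d : ℕ} [NeZero L]
    [Nonempty (Fin d)] {T : G → G} {U : ZMod L → G →* Matrix.unitaryGroup (Fin d) ℂ}
    (hTU : ∀ g, translation d L * chainOp U L g * (translation d L)ᴴ = chainOp U L (T g))
    (j : ZMod L) (g : G) : ∃ z : Circle, U (j + 1) g = z • U j (T g) := by
  have hprod : ∀ s t : Fin L → Fin d,
      ∏ i : Fin L, (U (((i : ℕ) : ZMod L) + 1) g : Matrix _ _ ℂ) (s i) (t i) =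
        ∏ i : Fin L, (U ((i : ℕ) : ZMod L) (T g) : Matrix _ _ ℂ) (s i) (t i) := fun s t => by
    have hshift := translation_mul_mul_apply (chainOp U L g) (s ∘ (finRotate L).symm)
      (t ∘ (finRotate L).symm)
    rw [hTU, Function.comp_assoc, Function.comp_assoc, Equiv.symm_comp_self, Function.comp_id,
      Function.comp_id] at hshift
    simp only [chainOp, Matrix.of_apply] at hshift
    rw [hshift]
    refine Fintype.prod_equiv (finRotate L) _ _ fun i => ?_
    rw [natCast_finRotate, Function.comp_apply, Function.comp_apply, Equiv.symm_apply_apply]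
  obtain ⟨c, hc⟩ := exists_smul_eq_of_prod_apply_eq (fun i => unitary_coe_ne_zero _) hprod
    ⟨j.val, j.val_lt⟩
  simp only [ZMod.natCast_val, ZMod.cast_id', id_eq] at hc
  exact exists_circle_smul_eq_of_coe_eq_smul hc

end Translation

section CovariantPhases

theorem exists_equivariant_map {K X : Type*} [Group K] [MulAction K X]
    (hfree : ∀ x : X, Function.Injective fun k : K => k • x) :
    ∃ c : X → K, ∀ k x, c (k • x) = k * c x := by
  let rep : X → X := fun x => (Quotient.mk (MulAction.orbitRel K X) x).out
  have hrep : ∀ k x, rep (k • x) = rep x := fun k x =>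
    congrArg Quotient.out (Quotient.sound (MulAction.mem_orbit x k))
  have hmem : ∀ x, ∃ k : K, k • rep x = x := fun x =>
    (MulAction.orbitRel K X).symm (Quotient.mk_out x)
  choose c hc using hmem
  refine ⟨c, fun k x => hfree (rep x) ?_⟩
  calc c (k • x) • rep x = k • x := by rw [← hrep k, hc]
    _ = (k * c x) • rep x := by rw [mul_smul, hc]

theorem circle_pow_surjective {n : ℕ} (hn : n ≠ 0) :
    Function.Surjective fun z : Circle => z ^ n := fun z =>
  ⟨Circle.exp (Complex.arg z / n), by
    simp only [← Circle.exp_natCast_mul, mul_div_cancel₀ _ (Nat.cast_ne_zero (R := ℝ).2 hn),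
      Circle.exp_arg]⟩

variable {G K : Type*} {L : ℕ} [NeZero L] [CommGroup K]

theorem exists_eq_mul_of_prod_eq_one (q : ZMod L → K) (hq : ∏ j, q j = 1) :
    ∃ θ : ZMod L → K, ∀ j, θ j = θ (j - 1) * q j := by
  let f : ℕ → K := fun n => ∏ i ∈ Finset.range n, q i
  have hf : f 0 = f L := by
    obtain ⟨n, rfl⟩ := Nat.exists_eq_succ_of_ne_zero (NeZero.ne L)
    exact hq.symm.trans ((Fintype.prod_congr _ _ fun i : Fin (n + 1) =>
      congrArg q (ZMod.natCast_zmod_val (n := n + 1) i).symm).trans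
        (Finset.prod_range fun i => q i).symm)
  refine ⟨fun j => f (j + 1).val, fun j => ?_⟩
  simp only [sub_add_cancel, apply_val_add_one hf, f, Finset.prod_range_succ,
    ZMod.natCast_zmod_val]

theorem exists_translation_covariant_phase {X : Type*} [MulAction K X]
    (hfree : ∀ x : X, Function.Injective fun k : K => k • x)
    (hroot : Function.Surjective fun z : K => z ^ L) {T : G → G} {x : ZMod L → G → X}
    {z : ZMod L → G → K} (hx : ∀ j g, x (j + 1) g = z j g • x j (T g)) {P : G → K}
    (hP : ∀ g, P g = (∏ j, z j g) * P (T g)) :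
    ∃ p : ZMod L → G → K, (∀ g, ∏ j, p j g = P g) ∧ ∀ j g, p (j + 1) g = z j g * p j (T g) := by
  obtain ⟨c, hc⟩ := exists_equivariant_map hfree
  choose r hr using hroot
  have hcT : ∀ g, ∏ j, c (x j g) = (∏ j, z j g) * ∏ j, c (x j (T g)) := fun g => by
    rw [← Finset.prod_mul_distrib, ← Equiv.prod_comp (Equiv.addRight 1)]
    exact Fintype.prod_congr _ _ fun j => by rw [Equiv.coe_addRight, hx, hc]
  have hratio : ∀ g, P g / ∏ j, c (x j g) = P (T g) / ∏ j, c (x j (T g)) := fun g => by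
    rw [hcT, hP, mul_div_mul_left_eq_div]
  refine ⟨fun j g => c (x j g) * r (P g / ∏ i, c (x i g)), fun g => ?_, fun j g => ?_⟩
  · rw [Finset.prod_mul_distrib, Finset.prod_const, Finset.card_univ, ZMod.card]
    exact (congrArg _ (hr _)).trans (mul_div_cancel _ _)
  · beta_reduce
    rw [hratio, hx, hc, mul_assoc]

end CovariantPhases

section CovariantFamily

variable {d χ : ℕ} {A : Fin d → Matrix (Fin χ) (Fin χ) ℂ}

theorem exists_smul_bondAct_eq_of_prod_eq {L : ℕ} [NeZero L]
    (v : ZMod L → Matrix.unitaryGroup (Fin χ) ℂ) {p p' : ZMod L → Circle}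
    (hp : ∏ j, p j = ∏ j, p' j) :
    ∃ v' : ZMod L → Matrix.unitaryGroup (Fin χ) ℂ,
      ∀ j, p j • bondAct (v (j - 1)) (v j) A = p' j • bondAct (v' (j - 1)) (v' j) A := by
  obtain ⟨θ, hθ⟩ := exists_eq_mul_of_prod_eq_one (fun j => p j / p' j)
    (by rw [Finset.prod_div_distrib, hp, div_self'])
  refine ⟨fun j => θ j • v j, fun j => ?_⟩
  rw [bondAct_smul, ← mul_smul, hθ j, inv_mul_cancel_left, mul_div_cancel]

theorem IsInjective.exists_phase_of_translation {J : Type*} [AddCommGroupWithOne J]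
    (hinj : IsInjective A) (hcan : IsLeftCanonical A) {W W' : J → Matrix.unitaryGroup (Fin d) ℂ}
    {v v' : J → Matrix.unitaryGroup (Fin χ) ℂ} {p p' z : J → Circle}
    (hv : ∀ j, siteAct (W j : Matrix (Fin d) (Fin d) ℂ) A = p j • bondAct (v (j - 1)) (v j) A)
    (hv' : ∀ j, siteAct (W' j : Matrix (Fin d) (Fin d) ℂ) A =
      p' j • bondAct (v' (j - 1)) (v' j) A)
    (hW : ∀ j, W (j + 1) = z j • W' j) :
    ∃ φ : J → Circle, (∀ j, v (j + 1) = φ j • v' j) ∧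
      ∀ j, p (j + 1) * φ j = z j * p' j * φ (j - 1) := by
  refine hinj.exists_phase_of_smul_bondAct_eq hcan (v := fun j => v (j + 1)) (v' := v')
    (p := fun j => p (j + 1)) (p' := fun j => z j * p' j) fun j => ?_
  have hj := hv (j + 1)
  rw [add_sub_cancel_right, hW, coe_circle_smul, siteAct_smul_left, hv', ← Circle.smul_def,
    ← mul_smul] at hj
  simp only [sub_add_cancel, hj]

theorem IsInjective.prod_phase_eq_of_translation {L : ℕ} [NeZero L]
    (hinj : IsInjective A) (hcan : IsLeftCanonical A)
    {W W' : ZMod L → Matrix.unitaryGroup (Fin d) ℂ}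
    {v v' : ZMod L → Matrix.unitaryGroup (Fin χ) ℂ} {p p' z : ZMod L → Circle}
    (hv : ∀ j, siteAct (W j : Matrix (Fin d) (Fin d) ℂ) A = p j • bondAct (v (j - 1)) (v j) A)
    (hv' : ∀ j, siteAct (W' j : Matrix (Fin d) (Fin d) ℂ) A =
      p' j • bondAct (v' (j - 1)) (v' j) A)
    (hW : ∀ j, W (j + 1) = z j • W' j) : ∏ j, p j = (∏ j, z j) * ∏ j, p' j := by
  obtain ⟨φ, -, hφ⟩ := hinj.exists_phase_of_translation hcan hv hv' hW
  have hp : ∏ j, p (j + 1) = ∏ j, p j := Equiv.prod_comp (Equiv.addRight 1) p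
  have hφ' : ∏ j, φ (j - 1) = ∏ j, φ j := Equiv.prod_comp (Equiv.subRight 1) φ
  have hprod := Fintype.prod_congr _ _ hφ
  rw [Finset.prod_mul_distrib, Finset.prod_mul_distrib, Finset.prod_mul_distrib, hp, hφ'] at hprod
  exact mul_right_cancel hprod

variable {G : Type*} [Group G] {L : ℕ} {T : MulAut G}
  {U : ZMod L → G →* Matrix.unitaryGroup (Fin d) ℂ} {lam : ZMod L → G → Circle}

theorem isCovariantPhase_iff [Nonempty (Fin d)] (hlam : ∀ j g, U (j + 1) g = lam j g • U j (T g))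
    {p : ℤ → G → Circle} :
    IsCovariantPhase T U p ↔ ∀ (j : ℤ) g, p (j + 1) g = lam j g * p j (T g) := by
  refine forall₂_congr fun j g => ?_
  rw [hlam, mul_comm, ← (circle_smul_left_injective (U j (T g))).eq_iff, Subtype.ext_iff]
  simp only [mul_smul, coe_circle_smul]

theorem exists_isPushThrough_isCovariantPhase [Nonempty (Fin d)] [NeZero L]
    (hcan : IsLeftCanonical A) (hinj : IsInjective A)
    (hlam : ∀ j g, U (j + 1) g = lam j g • U j (T g))
    (hsym : ∀ g, ∃ᶠ k in atTop, ∃ z : Circle, chainOp U (k * L) g *ᵥ mpsState A (k * L) =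
      (z : ℂ) • mpsState A (k * L)) :
    ∃ (v : ℤ → G → Matrix.unitaryGroup (Fin χ) ℂ) (p : ℤ → G → Circle),
      IsPushThrough U A v p ∧ IsCovariantPhase T U p ∧ ∀ j : ℤ, v (j + L) = v j := by
  choose q v₀ hv₀ using fun g => exists_siteAct_eq_smul_bondAct hcan hinj (hsym g)
  obtain ⟨p, hp, hpT⟩ := exists_translation_covariant_phase (x := fun j g => U j g)
    circle_smul_left_injective (circle_pow_surjective (NeZero.ne L)) hlam fun g =>
      hinj.prod_phase_eq_of_translation hcan (p := fun _ => q g) (p' := fun _ => q (T g))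
        (hv₀ g) (hv₀ (T g)) fun j => hlam j g
  choose v hv using fun g => exists_smul_bondAct_eq_of_prod_eq (A := A) (v₀ g) (hp g).symm
  refine ⟨fun j g => v g j, fun j => p j, isPushThrough_iff.2 fun j g => ?_,
    (isCovariantPhase_iff hlam).2 fun j g => ?_, fun j => ?_⟩
  · rw [hv₀, hv, Int.cast_sub, Int.cast_one]
  · rw [Int.cast_add, Int.cast_one, hpT]
  · simp only [Int.cast_add, Int.cast_natCast, CharP.cast_eq_zero, add_zero]

end CovariantFamily

section Cohomology

universe u

variable {G : Type u} [Group G]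

theorem exists_cocycle_val_eq {w : G → G → Circle}
    (hw : ∀ g h k, w (g * h) k * w g h = w h k * w g (h * k)) : ∃ ω : Cocycle G, ω.val = w :=
  ⟨⟨fun x => Additive.ofMul (ULift.up (w x.1 x.2)),
    (groupCohomology.mem_cocycles₂_iff (A := U1 G) _).2 fun g h k =>
      congrArg (fun z => Additive.ofMul (ULift.up z)) (hw g h k)⟩, rfl⟩

theorem Cocycle.cls_eq_of_val_mul_eq {ω ω' : Cocycle G} (b : G → Circle)
    (hb : ∀ g h, ω.val g h * b (g * h) = b g * b h * ω'.val g h) : ω.cls = ω'.cls := by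
  refine (groupCohomology.H2π_eq_iff (A := U1 G) ω ω').2
    ⟨fun g => Additive.ofMul (ULift.up (b g)), funext fun ⟨g, h⟩ => ?_⟩
  have hdiv : b h / b (g * h) * b g = ω.val g h / ω'.val g h := by
    rw [div_mul_eq_mul_div, div_eq_div_iff_mul_eq_mul, hb, mul_comm (b h) (b g)]
  exact congrArg (fun z => Additive.ofMul (ULift.up z)) hdiv

variable {H : Type*} [Semigroup H] [MulAction Circle H] [IsScalarTower Circle H H]
  [SMulCommClass Circle H H]

theorem exists_cocycle_of_mul_eq_smul
    (hfree : ∀ x : H, Function.Injective fun z : Circle => z • x) {u : G → H} {w : G → G → Circle}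
    (hu : ∀ g h, u g * u h = w g h • u (g * h)) : ∃ ω : Cocycle G, ω.val = w := by
  refine exists_cocycle_val_eq fun g h k => hfree (u (g * h * k)) ?_
  calc (w (g * h) k * w g h) • u (g * h * k) = u g * u h * u k := by
        rw [mul_comm, mul_smul, ← hu, ← smul_mul_assoc, ← hu]
    _ = u g * (u h * u k) := mul_assoc _ _ _
    _ = (w h k * w g (h * k)) • u (g * h * k) := by
        rw [hu, mul_smul_comm, hu, ← mul_smul, mul_assoc g]

theorem Cocycle.cls_eq_of_eq_smul
    (hfree : ∀ x : H, Function.Injective fun z : Circle => z • x) {ω ω' : Cocycle G}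
    {u u' : G → H} {φ : G → Circle}
    (hu : ∀ g h, u g * u h = ω.val g h • u (g * h))
    (hu' : ∀ g h, u' g * u' h = ω'.val g h • u' (g * h)) (hφ : ∀ g, u g = φ g • u' g) :
    ω.cls = ω'.cls := by
  refine Cocycle.cls_eq_of_val_mul_eq φ fun g h => hfree (u' (g * h)) ?_
  calc (ω.val g h * φ (g * h)) • u' (g * h) = u g * u h := by rw [mul_smul, ← hφ, hu]
    _ = (φ g * φ h * ω'.val g h) • u' (g * h) := by
        rw [hφ, hφ, smul_mul_assoc, mul_smul_comm, hu', mul_smul, mul_smul]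

end Cohomology

section BondPhases

theorem eq_of_eq_apply_sub_one {α : Type*} {f : ℤ → α} (hf : ∀ j, f j = f (j - 1)) (i j : ℤ) :
    f i = f j := by
  have hper : Function.Periodic f 1 := fun j => by rw [hf, add_sub_cancel_right]
  have hzero : ∀ j, f j = f 0 := fun j => by
    simpa only [mul_one, Int.cast_id] using hper.int_mul_eq j
  rw [hzero i, hzero j]

variable {G : Type*} [Group G] {L d χ : ℕ} {U : ZMod L → G →* Matrix.unitaryGroup (Fin d) ℂ}
  {A : Fin d → Matrix (Fin χ) (Fin χ) ℂ} {v : ℤ → G → Matrix.unitaryGroup (Fin χ) ℂ}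
  {p : ℤ → G → Circle}

theorem IsPushThrough.exists_translation_phase (hv : IsPushThrough U A v p)
    (hcan : IsLeftCanonical A) (hinj : IsInjective A) {T : MulAut G} {lam : ZMod L → G → Circle}
    (hlam : ∀ j g, U (j + 1) g = lam j g • U j (T g)) :
    ∃ φ : ℤ → G → Circle, (∀ j g, v (j + 1) g = φ j g • v j (T g)) ∧
      ∀ (j : ℤ) g, p (j + 1) g * φ j g = lam j g * p j (T g) * φ (j - 1) g := by
  rw [isPushThrough_iff] at hv
  choose φ hφ hp using fun g => hinj.exists_phase_of_translation hcan
    (W := fun j : ℤ => U j g) (W' := fun j => U j (T g)) (z := fun j => lam j g)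
    (v := fun j => v j g) (v' := fun j => v j (T g)) (p := fun j => p j g)
    (p' := fun j => p j (T g)) (hv · g) (hv · (T g)) fun j => by
      rw [Int.cast_add, Int.cast_one, hlam]
  exact ⟨fun j g => φ g j, fun j g => hφ g j, fun j g => hp g j⟩

theorem IsPushThrough.exists_uniform_translation_phase [Nonempty (Fin d)]
    (hv : IsPushThrough U A v p) (hcan : IsLeftCanonical A) (hinj : IsInjective A) {T : MulAut G}
    {lam : ZMod L → G → Circle} (hlam : ∀ j g, U (j + 1) g = lam j g • U j (T g))
    (hcov : IsCovariantPhase T U p) :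
    ∃ φ : G → Circle, ∀ j g, v (j + 1) g = φ g • v j (T g) := by
  obtain ⟨φ, hφ, hp⟩ := hv.exists_translation_phase hcan hinj hlam
  have hstep : ∀ j, φ j = φ (j - 1) := fun j => funext fun g => by
    have hpg := hp j g
    rw [(isCovariantPhase_iff hlam).1 hcov] at hpg
    exact mul_left_cancel hpg
  exact ⟨φ 0, fun j g => by rw [hφ, eq_of_eq_apply_sub_one hstep j 0]⟩

theorem IsPushThrough.exists_mul_phase (hv : IsPushThrough U A v p)
    (hcan : IsLeftCanonical A) (hinj : IsInjective A) :
    ∃ w : ℤ → G → G → Circle, (∀ j g h, v j g * v j h = w j g h • v j (g * h)) ∧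
      ∀ j g h, p j g * p j h * w j g h = p j (g * h) * w (j - 1) g h := by
  rw [isPushThrough_iff] at hv
  choose w hw hp using fun g h => hinj.exists_phase_of_smul_bondAct_eq hcan
    (v := fun j => v j g * v j h) (v' := fun j => v j (g * h)) (p := fun j => p j g * p j h)
    (p' := fun j => p j (g * h)) fun j => by
      rw [← hv, map_mul, Matrix.UnitaryGroup.mul_val, siteAct_mul, hv, Circle.smul_def (p j h),
        siteAct_smul_right, siteAct_bondAct, hv, bondAct_smul_right, ← bondAct_mul,
        ← Circle.smul_def, ← mul_smul, mul_comm (p j h)]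
  exact ⟨fun j g h => w g h j, fun j g h => hw g h j, fun j g h => hp g h j⟩

theorem IsPushThrough.exists_cocycle (hv : IsPushThrough U A v p)
    (hcan : IsLeftCanonical A) (hinj : IsInjective A) :
    ∃ ω : ℤ → Cocycle G, (∀ j g h, v j g * v j h = (ω j).val g h • v j (g * h)) ∧
      ∀ i j, (ω i).cls = (ω j).cls := by
  have hne := hinj.nonempty
  obtain ⟨w, hw, hp⟩ := hv.exists_mul_phase hcan hinj
  choose ω hω using fun j => exists_cocycle_of_mul_eq_smul circle_smul_left_injective (hw j)
  refine ⟨ω, fun j g h => by rw [hω, hw],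
    eq_of_eq_apply_sub_one (f := fun j => (ω j).cls) fun j => ?_⟩
  refine Cocycle.cls_eq_of_val_mul_eq (fun g => (p j g)⁻¹) fun g h => ?_
  rw [hω, hω, ← mul_inv, mul_inv_eq_iff_eq_mul, mul_assoc, ← mul_comm (p j (g * h)), ← hp,
    inv_mul_cancel_left]

theorem cls_pullback_eq_of_eq_smul [Nonempty (Fin χ)] {ω : ℤ → Cocycle G}
    (hω : ∀ j g h, v j g * v j h = (ω j).val g h • v j (g * h)) {T : MulAut G}
    {φ : ℤ → G → Circle} (hφ : ∀ j g, v (j + 1) g = φ j g • v j (T g)) (j : ℤ) :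
    (ω (j + 1)).cls = ((ω j).pullback T).cls := by
  refine Cocycle.cls_eq_of_eq_smul circle_smul_left_injective (hω (j + 1)) (fun g h => ?_) (hφ j)
  rw [hω, map_mul]
  rfl

end BondPhases

end ModulatedMPS

end

open ModulatedMPS in
theorem mainTheorem2_general {G : Type*} [Group G] {L d χ : ℕ} [NeZero L]
    (T : MulAut G) (U : ZMod L → G →* Matrix.unitaryGroup (Fin d) ℂ)
    (hTU : ∀ g : G, translation d L * chainOp U L g * (translation d L)ᴴ = chainOp U L (T g))
    (A : Fin d → Matrix (Fin χ) (Fin χ) ℂ)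
    (hcan : IsLeftCanonical A) (hinj : IsInjective A)
    (hsym : ∀ g : G, ∃ᶠ k in Filter.atTop, ∃ z : Circle,
      chainOp U (k * L) g *ᵥ mpsState A (k * L) = (z : ℂ) • mpsState A (k * L)) :
    (∃ (v : ℤ → G → Matrix.unitaryGroup (Fin χ) ℂ) (p : ℤ → G → Circle),
      IsPushThrough U A v p ∧ IsCovariantPhase T U p ∧ ∀ j : ℤ, v (j + L) = v j) ∧
    ∀ (v : ℤ → G → Matrix.unitaryGroup (Fin χ) ℂ) (p : ℤ → G → Circle),
      IsPushThrough U A v p →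
      (∃ φ : ℤ → G → Circle, ∀ (j : ℤ) (g : G),
        (v (j + 1) g : Matrix (Fin χ) (Fin χ) ℂ) =
          (φ j g : ℂ) • (v j (T g) : Matrix (Fin χ) (Fin χ) ℂ)) ∧
      (IsCovariantPhase T U p →
        ∃ φ : G → Circle, ∀ (j : ℤ) (g : G),
          (v (j + 1) g : Matrix (Fin χ) (Fin χ) ℂ) =
            (φ g : ℂ) • (v j (T g) : Matrix (Fin χ) (Fin χ) ℂ)) ∧
      ∃ ω : ℤ → Cocycle G,
        (∀ (j : ℤ) (g h : G),
          (v j g : Matrix (Fin χ) (Fin χ) ℂ) * (v j h : Matrix (Fin χ) (Fin χ) ℂ) =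
            ((ω j).val g h : ℂ) • (v j (g * h) : Matrix (Fin χ) (Fin χ) ℂ)) ∧
        (∀ i j : ℤ, (ω i).cls = (ω j).cls) ∧
        ∀ j : ℤ, (ω j).cls = ((ω j).pullback T).cls := by
  have hχ := hinj.nonempty
  have hd := hcan.nonempty_physical
  choose lam hlam using exists_circle_smul_eq_of_translation hTU
  refine ⟨exists_isPushThrough_isCovariantPhase hcan hinj hlam hsym, fun v p hv => ?_⟩
  obtain ⟨φ, hφ, -⟩ := hv.exists_translation_phase hcan hinj hlam
  obtain ⟨ω, hω, hcls⟩ := hv.exists_cocycle hcan hinj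
  refine ⟨⟨φ, fun j g => congrArg Subtype.val (hφ j g)⟩, fun hcov => ?_, ω,
    fun j g h => congrArg Subtype.val (hω j g h), hcls, fun j =>
      (hcls j (j + 1)).trans (cls_pullback_eq_of_eq_smul hω hφ j)⟩
  obtain ⟨φ', hφ'⟩ := hv.exists_uniform_translation_phase hcan hinj hlam hcov
  exact ⟨φ', fun j g => congrArg Subtype.val (hφ' j g)⟩

theorem mainTheorem2 {G : Type*} [Group G] {L d χ : ℕ} [NeZero L]
    (T : MulAut G) (hT : T ^ L = 1)
    (U : ZMod L → G →* Matrix.unitaryGroup (Fin d) ℂ)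
    (hTU : ∀ g : G,
      ModulatedMPS.translation d L * ModulatedMPS.chainOp U L g *
        (ModulatedMPS.translation d L)ᴴ = ModulatedMPS.chainOp U L (T g))
    (A : Fin d → Matrix (Fin χ) (Fin χ) ℂ)
    (hcan : ModulatedMPS.IsLeftCanonical A) (hinj : ModulatedMPS.IsInjective A)
    (hsym : ∀ (g : G) (k : ℕ), 1 ≤ k → ∃ z : Circle,
      ModulatedMPS.chainOp U (k * L) g *ᵥ ModulatedMPS.mpsState A (k * L) =
        (z : ℂ) • ModulatedMPS.mpsState A (k * L)) :
    (∃ (v : ℤ → G → Matrix.unitaryGroup (Fin χ) ℂ) (p : ℤ → G → Circle),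
      ModulatedMPS.IsPushThrough U A v p ∧ ModulatedMPS.IsCovariantPhase T U p ∧
        ∀ j : ℤ, v (j + L) = v j) ∧
    ∀ (v : ℤ → G → Matrix.unitaryGroup (Fin χ) ℂ) (p : ℤ → G → Circle),
      ModulatedMPS.IsPushThrough U A v p →
      (∃ φ : ℤ → G → Circle, ∀ (j : ℤ) (g : G),
        (v (j + 1) g : Matrix (Fin χ) (Fin χ) ℂ) =
          (φ j g : ℂ) • (v j (T g) : Matrix (Fin χ) (Fin χ) ℂ)) ∧
      (ModulatedMPS.IsCovariantPhase T U p →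
        ∃ φ : G → Circle, ∀ (j : ℤ) (g : G),
          (v (j + 1) g : Matrix (Fin χ) (Fin χ) ℂ) =
            (φ g : ℂ) • (v j (T g) : Matrix (Fin χ) (Fin χ) ℂ)) ∧
      ∃ ω : ℤ → ModulatedMPS.Cocycle G,
        (∀ (j : ℤ) (g h : G),
          (v j g : Matrix (Fin χ) (Fin χ) ℂ) * (v j h : Matrix (Fin χ) (Fin χ) ℂ) =
            ((ω j).val g h : ℂ) • (v j (g * h) : Matrix (Fin χ) (Fin χ) ℂ)) ∧
        (∀ i j : ℤ, (ω i).cls = (ω j).cls) ∧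
        ∀ j : ℤ, (ω j).cls = ((ω j).pullback T).cls :=
  mainTheorem2_general T U hTU A hcan hinj fun g =>
    (Filter.eventually_ge_atTop 1).frequently.mono fun k hk => hsym g k hk
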